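/- **Conventions.** Let $A$ be a monoidal category, $B$ a braided monoidal category with braiding $\beta$, and $F : A \to B$ a separable Frobenius functor: $F$ carries a monoidal structure $\varepsilon_F : e \to Fe$, $\mu_{x,y} : Fx\otimes Fy \to F(x\otimes y)$ and a comonoidal structure $\eta_F : Fe\to e$, $\delta_{x,y} : F(x\otimes y)\to Fx\otimes Fy$ such that (suppressing associativities; composition is written left to right with $;$) $$(\delta_{x,y}\otimes Fz);(Fx\otimes\mu_{y,z}) = \mu_{x\otimes y,z};\delta_{x,y\otimes z},\qquad (Fx\otimes\delta_{y,z});(\mu_{x,y}\otimes Fz)=\mu_{x,y\otimes z};\delta_{x\otimes y,z},\qquad \delta_{x,y};\mu_{x,y}=\mathrm{id}.$$ A left dual of $c$ is an object $Lc$ with $\mathrm{ev}: Lc\otimes c\to e$ and $\mathrm{coev}: e\to c\otimes Lc$ satisfying the triangle identities; a right dual is an object $Rc$ with $\mathrm{ev}: c\otimes Rc\to e$ and $\mathrm{coev}: e\to Rc\otimes c$ satisfying them. A *weak bialgebra* in $B$ is an object $H$ with a monoid structure $(\mu,\eta)$ and a comonoid structure $(\Delta,\epsilon)$ such that $\mu;\Delta=(\Delta\otimes\Delta);(H\otimes\beta\otimes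 H);(\mu\otimes\mu)$, $$\eta;\Delta;(\Delta\otimes H) = ((\eta;\Delta)\otimes(\eta;\Delta));(H\otimes\mu\otimes H) = ((\eta;\Delta)\otimes(\eta;\Delta));(H\otimes(\beta^{-1};\mu)\otimes H),$$ $$(\mu\otimes H);\mu;\epsilon=(H\otimes\Delta\otimes H);((\mu;\epsilon)\otimes(\mu;\epsilon))=(H\otimes(\Delta;\beta^{-1})\otimes H);((\mu;\epsilon)\otimes(\mu;\epsilon)).$$ Write $f\star g=\Delta;(f\otimes g);\mu$ for convolution, and let the *source* and *target* maps $H\to H$ be $$s=(H\otimes(\eta;\Delta));(\beta_{H,H}\otimes H);(H\otimes(\mu;\epsilon)),\qquad t=((\eta;\Delta)\otimes H);(H\otimes\beta_{H,H});((\mu;\epsilon)\otimes H),$$ that is, $s(h)=1_1\,\epsilon(h1_2)$ and $t(h)=\epsilon(1_1h)\,1_2$. A *weak Hopf algebra* is a weak bialgebra with a map $S:H\to H$ (a *weak antipode*) such that $S\star \mathrm{id}=s$, $\mathrm{id}\star S=t$ and $S\star\mathrm{id}\star S=S$. **Theorem (end form).** Suppose that $A$ and $B$ have left duals, put $[a,b]=b\otimes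 La$ in $B$, and suppose that the end $E=E_F=\int_{a\in A}[Fa,Fa]$ exists. Let $\alpha_x : E\otimes Fx\to [Fx,Fx]\otimes Fx\to Fx$ be given by projection and evaluation, and let $\alpha_{x,y}=(E\otimes\beta_{E,Fx}\otimes Fy);(\alpha_x\otimes\alpha_y) : E\otimes E\otimes Fx\otimes Fy\to Fx\otimes Fy$. Then there are unique maps $\eta,\mu,\epsilon,\Delta,S$ on $E$ such that for all objects $x,y$ of $A$ $$(\eta\otimes Fx);\alpha_x=\mathrm{id},\qquad (\mu\otimes Fx);\alpha_x=(E\otimes\alpha_x);\alpha_x,\qquad \epsilon=(E\otimes\varepsilon_F);\alpha_e;\eta_F,$$ $$(\Delta\otimes Fx\otimes Fy);\alpha_{x,y}=(E\otimes\mu_{x,y});\alpha_{x\otimes y};\delta_{x,y},$$ $$(S\otimes Fx);\alpha_x=(E\otimes c_x\otimes Fx);(\beta_{E,Fx}\otimes FLx\otimes Fx);(Fx\otimes\alpha_{Lx}\otimes Fx);(Fx\otimes d_x),$$ where $c_x : e\to Fe\to F(x\otimes Lx)\to Fx\otimes FLx$ and $d_x : FLx\otimes Fx\to F(Lx\otimes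 x)\to Fe\to e$ are built from $\mathrm{coev}$, $\mathrm{ev}$ and the structure of $F$. With these maps $E_F$ is a weak Hopf algebra in $B$; in particular $S$ is a weak antipode: $S\star\mathrm{id}=s$, $\mathrm{id}\star S=t$ and $S\star\mathrm{id}\star S=S$. **Theorem (coend form).** Dually, suppose that $A$ and $B$ have right duals and that the coend $E=\int^{a\in A}Fa\otimes R(Fa)$ exists, and let $\gamma_x : Fx\to Fx\otimes R(Fx)\otimes Fx\to E\otimes Fx$ be the canonical coaction and $\gamma_{x,y}=(\gamma_x\otimes\gamma_y);(E\otimes\beta_{Fx,E}\otimes Fy)$. Then there are unique maps $\eta,\mu,\epsilon,\Delta,S$ on $E$ such that for all $x,y$ $$\gamma_x;(\epsilon\otimes Fx)=\mathrm{id},\qquad \gamma_x;(\Delta\otimes Fx)=\gamma_x;(E\otimes\gamma_x),\qquad \eta=\varepsilon_F;\gamma_e;(E\otimes\eta_F),$$ $$\gamma_{x,y};(\mu\otimes Fx\otimes Fy)=\mu_{x,y};\gamma_{x\otimes y};(E\otimes\delta_{x,y}),$$ $$\gamma_x;(S\otimes Fx)=(Fx\otimes c'_x);(Fx\otimes\gamma_{Rx}\otimes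 Fx);(\beta_{Fx,E}\otimes FRx\otimes Fx);(E\otimes d'_x\otimes Fx),$$ where $c'_x : e\to Fe\to F(Rx\otimes x)\to FRx\otimes Fx$ and $d'_x : Fx\otimes FRx\to F(x\otimes Rx)\to Fe\to e$; and with these maps $E$ is a weak Hopf algebra in $B$. -/

import Mathlib

open CategoryTheory MonoidalCategory Limits Opposite

universe v₁ u₁ v₂ u₂

namespace WeakTannaka

section FrobeniusFunctor

variable {A : Type u₁} [Category.{v₁} A] [MonoidalCategory A]
  {B : Type u₂} [Category.{v₂} B] [MonoidalCategory B]

open Functor.LaxMonoidal Functor.OplaxMonoidal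

/-- A functor `F` with a monoidal (`ε`, `μ`) and a comonoidal (`η`, `δ`) structure is a separable
Frobenius functor if the two Frobenius axioms hold and
`F (x ⊗ y) ⟶ F x ⊗ F y ⟶ F (x ⊗ y)` is the identity. -/
class IsSeparableFrobenius (F : A ⥤ B) [F.LaxMonoidal] [F.OplaxMonoidal] : Prop where
  frobenius_left (x y z : A) :
    δ F x y ▷ F.obj z ≫ (α_ (F.obj x) (F.obj y) (F.obj z)).hom ≫ F.obj x ◁ μ F y z =
      μ F (x ⊗ y) z ≫ F.map (α_ x y z).hom ≫ δ F x (y ⊗ z)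
  frobenius_right (x y z : A) :
    F.obj x ◁ δ F y z ≫ (α_ (F.obj x) (F.obj y) (F.obj z)).inv ≫ μ F x y ▷ F.obj z =
      μ F x (y ⊗ z) ≫ F.map (α_ x y z).inv ≫ δ F (x ⊗ y) z
  separable (x y : A) : δ F x y ≫ μ F x y = 𝟙 (F.obj (x ⊗ y))

end FrobeniusFunctor

section WeakHopf

variable {C : Type u₂} [Category.{v₂} C] [MonoidalCategory C] [BraidedCategory C]

open scoped MonObj ComonObj

/-- A weak bialgebra in a braided monoidal category: a monoid and comonoid whose comultiplication
is multiplicative, subject to the weak unit and weak counit axioms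
`(Δ ⊗ 1) Δ(1) = 1₁ ⊗ 1₂ 1'₁ ⊗ 1'₂ = 1₁ ⊗ 1'₁ 1₂ ⊗ 1'₂` and
`ε(h k l) = ε(h k₁) ε(k₂ l) = ε(h k₂) ε(k₁ l)`. -/
class WeakBimonObj (M : C) extends MonObj M, ComonObj M where
  mul_comul : μ[M] ≫ Δ[M] = (Δ[M] ⊗ₘ Δ[M]) ≫ tensorμ M M M M ≫ (μ[M] ⊗ₘ μ[M])
  one_comul_comul : η[M] ≫ Δ[M] ≫ Δ[M] ▷ M =
    (λ_ (𝟙_ C)).inv ≫ ((η[M] ≫ Δ[M]) ⊗ₘ (η[M] ≫ Δ[M])) ⊗≫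
      M ◁ μ[M] ▷ M ≫ (α_ M M M).inv
  one_comul_comul' : η[M] ≫ Δ[M] ≫ Δ[M] ▷ M =
    (λ_ (𝟙_ C)).inv ≫ ((η[M] ≫ Δ[M]) ⊗ₘ (η[M] ≫ Δ[M])) ⊗≫
      M ◁ ((β_ M M).inv ≫ μ[M]) ▷ M ≫ (α_ M M M).inv
  mul_mul_counit : μ[M] ▷ M ≫ μ[M] ≫ ε[M] =
    (α_ M M M).hom ≫ M ◁ Δ[M] ▷ M ⊗≫
      ((μ[M] ≫ ε[M]) ⊗ₘ (μ[M] ≫ ε[M])) ≫ (λ_ (𝟙_ C)).hom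
  mul_mul_counit' : μ[M] ▷ M ≫ μ[M] ≫ ε[M] =
    (α_ M M M).hom ≫ M ◁ (Δ[M] ≫ (β_ M M).inv) ▷ M ⊗≫
      ((μ[M] ≫ ε[M]) ⊗ₘ (μ[M] ≫ ε[M])) ≫ (λ_ (𝟙_ C)).hom

/-- The source map `h ↦ 1₁ ε(h 1₂)` of a monoid-and-comonoid. -/
def sourceMap (M : C) [MonObj M] [ComonObj M] : M ⟶ M :=
  (ρ_ M).inv ≫ M ◁ (η[M] ≫ Δ[M]) ⊗≫ (β_ M M).hom ▷ M ⊗≫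
    M ◁ (μ[M] ≫ ε[M]) ≫ (ρ_ M).hom

/-- The target map `h ↦ ε(1₁ h) 1₂` of a monoid-and-comonoid. -/
def targetMap (M : C) [MonObj M] [ComonObj M] : M ⟶ M :=
  (λ_ M).inv ≫ (η[M] ≫ Δ[M]) ▷ M ⊗≫ M ◁ (β_ M M).hom ⊗≫
    (μ[M] ≫ ε[M]) ▷ M ≫ (λ_ M).hom

/-- The convolution product of two endomorphisms of a monoid-and-comonoid. -/
def convolution {M : C} [MonObj M] [ComonObj M] (f g : M ⟶ M) : M ⟶ M :=
  Δ[M] ≫ (f ⊗ₘ g) ≫ μ[M]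

/-- A weak Hopf algebra in a braided monoidal category: a weak bialgebra with a weak antipode. -/
class WeakHopfObj (M : C) extends WeakBimonObj M where
  antipode : M ⟶ M
  antipode_convolution_id : convolution antipode (𝟙 M) = sourceMap M
  id_convolution_antipode : convolution (𝟙 M) antipode = targetMap M
  antipode_convolution_id_convolution_antipode :
    convolution (convolution antipode (𝟙 M)) antipode = antipode

/-- The raw data (no axioms) underlying a weak Hopf algebra structure on `M`. -/
@[ext]
structure HopfData (M : C) where
  one : 𝟙_ C ⟶ M
  mul : M ⊗ M ⟶ M
  counit : M ⟶ 𝟙_ C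
  comul : M ⟶ M ⊗ M
  antipode : M ⟶ M

/-- The data underlying a weak Hopf algebra. -/
def WeakHopfObj.data {M : C} (W : WeakHopfObj M) : HopfData M where
  one := W.one
  mul := W.mul
  counit := W.counit
  comul := W.comul
  antipode := W.antipode

end WeakHopf

section Hom

variable {A : Type u₁} [Category.{v₁} A] {B : Type u₂} [Category.{v₂} B] [MonoidalCategory B]

/-- The functor `(a, b) ↦ [F a, F b] = F b ⊗ L (F a)`, where `L c` is the dual of `c` with
`L c ⊗ c ⟶ 𝟙` and `𝟙 ⟶ c ⊗ L c`. (Mathlib calls `L c` the right dual and writes `cᘁ`.) -/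
def homFunctor [RightRigidCategory B] (F : A ⥤ B) : Aᵒᵖ ⥤ A ⥤ B where
  obj a :=
    { obj := fun b => F.obj b ⊗ (F.obj a.unop)ᘁ
      map := fun g => F.map g ▷ (F.obj a.unop)ᘁ }
  map {a a'} f := { app := fun b => F.obj b ◁ ((F.map f.unop)ᘁ)
                    naturality := fun _ _ g => (whisker_exchange (F.map g) _).symm }
  map_id a := by ext b; simp
  map_comp f g := by ext b; simp [comp_rightAdjointMate]

/-- The functor `(a, b) ↦ F b ⊗ R (F a)`, where `R c` is the dual of `c` with
`c ⊗ R c ⟶ 𝟙` and `𝟙 ⟶ R c ⊗ c`. (Mathlib calls `R c` the left dual and writes `ᘁc`.)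
In a braided category this is again an internal hom `[F a, F b]`. -/
def cohomFunctor [LeftRigidCategory B] (F : A ⥤ B) : Aᵒᵖ ⥤ A ⥤ B where
  obj a :=
    { obj := fun b => F.obj b ⊗ (ᘁ(F.obj a.unop))
      map := fun g => F.map g ▷ (ᘁ(F.obj a.unop)) }
  map {a a'} f := { app := fun b => F.obj b ◁ (ᘁ(F.map f.unop))
                    naturality := fun _ _ g => (whisker_exchange (F.map g) _).symm }
  map_id a := by ext b; simp
  map_comp f g := by ext b; simp [comp_leftAdjointMate]

/-- The projection `E ⟶ [F x, F x]` of a wedge with vertex `E`. -/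
def proj [RightRigidCategory B] {F : A ⥤ B} (c : Wedge (homFunctor F)) (x : A) :
    c.pt ⟶ F.obj x ⊗ (F.obj x)ᘁ := c.ι x

/-- The canonical action `E ⊗ F x ⟶ [F x, F x] ⊗ F x ⟶ F x` for a wedge with vertex `E`. -/
def action [RightRigidCategory B] {F : A ⥤ B} (c : Wedge (homFunctor F)) (x : A) :
    c.pt ⊗ F.obj x ⟶ F.obj x :=
  proj c x ▷ F.obj x ≫ (α_ (F.obj x) ((F.obj x)ᘁ) (F.obj x)).hom ≫
    F.obj x ◁ ε_ (F.obj x) ((F.obj x)ᘁ) ≫ (ρ_ (F.obj x)).hom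

/-- The inclusion `F x ⊗ R (F x) ⟶ E` of a cowedge with vertex `E`. -/
def incl [LeftRigidCategory B] {F : A ⥤ B} (c : Cowedge (cohomFunctor F)) (x : A) :
    F.obj x ⊗ (ᘁ(F.obj x)) ⟶ c.pt := c.π x

/-- The canonical coaction `F x ⟶ (F x ⊗ R (F x)) ⊗ F x ⟶ E ⊗ F x` for a cowedge with
vertex `E`. -/
def coaction [LeftRigidCategory B] {F : A ⥤ B} (c : Cowedge (cohomFunctor F)) (x : A) :
    F.obj x ⟶ c.pt ⊗ F.obj x :=
  (ρ_ (F.obj x)).inv ≫ F.obj x ◁ η_ (ᘁ(F.obj x)) (F.obj x) ≫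
    (α_ (F.obj x) (ᘁ(F.obj x)) (F.obj x)).inv ≫ incl c x ▷ F.obj x

variable [BraidedCategory B]

/-- The canonical action of `E ⊗ E` on `F x ⊗ F y`. -/
def action₂ [RightRigidCategory B] {F : A ⥤ B} (c : Wedge (homFunctor F)) (x y : A) :
    (c.pt ⊗ c.pt) ⊗ (F.obj x ⊗ F.obj y) ⟶ F.obj x ⊗ F.obj y :=
  tensorμ c.pt c.pt (F.obj x) (F.obj y) ≫ (action c x ⊗ₘ action c y)

/-- The canonical coaction of `E ⊗ E` on `F x ⊗ F y`. -/
def coaction₂ [LeftRigidCategory B] {F : A ⥤ B} (c : Cowedge (cohomFunctor F)) (x y : A) :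
    F.obj x ⊗ F.obj y ⟶ (c.pt ⊗ c.pt) ⊗ (F.obj x ⊗ F.obj y) :=
  (coaction c x ⊗ₘ coaction c y) ≫ tensorμ c.pt (F.obj x) c.pt (F.obj y)

end Hom

section Canonical

variable {A : Type u₁} [Category.{v₁} A] [MonoidalCategory A]
  {B : Type u₂} [Category.{v₂} B] [MonoidalCategory B] [BraidedCategory B]
  (F : A ⥤ B) [F.LaxMonoidal] [F.OplaxMonoidal]

/-- For a dual pair `x`, `y` in `A` (with `𝟙 ⟶ x ⊗ y` and `y ⊗ x ⟶ 𝟙`), the composite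
`𝟙 ⟶ F 𝟙 ⟶ F (x ⊗ y) ⟶ F x ⊗ F y`. -/
def mapCoev (x y : A) [ExactPairing x y] : 𝟙_ B ⟶ F.obj x ⊗ F.obj y :=
  Functor.LaxMonoidal.ε F ≫ F.map (η_ x y) ≫ Functor.OplaxMonoidal.δ F x y

/-- For a dual pair `x`, `y` in `A` (with `𝟙 ⟶ x ⊗ y` and `y ⊗ x ⟶ 𝟙`), the composite
`F y ⊗ F x ⟶ F (y ⊗ x) ⟶ F 𝟙 ⟶ 𝟙`. -/
def mapEv (x y : A) [ExactPairing x y] : F.obj y ⊗ F.obj x ⟶ 𝟙_ B :=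
  Functor.LaxMonoidal.μ F y x ≫ F.map (ε_ x y) ≫ Functor.OplaxMonoidal.η F

/-- `D` is the canonical data on the vertex `E` of a wedge: each structure map is given by its
discharged form, i.e. by the way it acts on the objects `F x` (or `F x ⊗ F y`). -/
structure IsCanonical [RightRigidCategory A] [RightRigidCategory B] {F : A ⥤ B}
    [F.LaxMonoidal] [F.OplaxMonoidal] (c : Wedge (homFunctor F)) (D : HopfData c.pt) : Prop where
  one (x : A) : D.one ▷ F.obj x ≫ action c x = (λ_ (F.obj x)).hom
  mul (x : A) : D.mul ▷ F.obj x ≫ action c x =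
    (α_ c.pt c.pt (F.obj x)).hom ≫ c.pt ◁ action c x ≫ action c x
  counit : D.counit = (ρ_ c.pt).inv ≫ c.pt ◁ Functor.LaxMonoidal.ε F ≫ action c (𝟙_ A) ≫
    Functor.OplaxMonoidal.η F
  comul (x y : A) : D.comul ▷ (F.obj x ⊗ F.obj y) ≫ action₂ c x y =
    c.pt ◁ Functor.LaxMonoidal.μ F x y ≫ action c (x ⊗ y) ≫ Functor.OplaxMonoidal.δ F x y
  antipode (x : A) : D.antipode ▷ F.obj x ≫ action c x =
    c.pt ◁ (λ_ (F.obj x)).inv ≫ c.pt ◁ mapCoev F x (xᘁ) ▷ F.obj x ⊗≫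
      (β_ c.pt (F.obj x)).hom ▷ (F.obj (xᘁ) ⊗ F.obj x) ⊗≫
        F.obj x ◁ action c (xᘁ) ▷ F.obj x ≫ F.obj x ◁ mapEv F x (xᘁ) ≫ (ρ_ (F.obj x)).hom

/-- `D` is the canonical data on the vertex `E` of a cowedge: each structure map is given by its
discharged form, in terms of the coactions on the objects `F x` (or `F x ⊗ F y`). -/
structure IsCocanonical [LeftRigidCategory A] [LeftRigidCategory B] {F : A ⥤ B}
    [F.LaxMonoidal] [F.OplaxMonoidal] (c : Cowedge (cohomFunctor F)) (D : HopfData c.pt) :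
    Prop where
  counit (x : A) : coaction c x ≫ D.counit ▷ F.obj x = (λ_ (F.obj x)).inv
  comul (x : A) : coaction c x ≫ D.comul ▷ F.obj x =
    coaction c x ≫ c.pt ◁ coaction c x ≫ (α_ c.pt c.pt (F.obj x)).inv
  one : D.one = Functor.LaxMonoidal.ε F ≫ coaction c (𝟙_ A) ≫
    c.pt ◁ Functor.OplaxMonoidal.η F ≫ (ρ_ c.pt).hom
  mul (x y : A) : coaction₂ c x y ≫ D.mul ▷ (F.obj x ⊗ F.obj y) =
    Functor.LaxMonoidal.μ F x y ≫ coaction c (x ⊗ y) ≫ c.pt ◁ Functor.OplaxMonoidal.δ F x y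
  antipode (x : A) : coaction c x ≫ D.antipode ▷ F.obj x =
    (ρ_ (F.obj x)).inv ≫ F.obj x ◁ mapCoev F (ᘁx) x ≫ F.obj x ◁ coaction c (ᘁx) ▷ F.obj x ⊗≫
      (β_ (F.obj x) c.pt).hom ▷ (F.obj (ᘁx) ⊗ F.obj x) ⊗≫
        c.pt ◁ mapEv F (ᘁx) x ▷ F.obj x ≫ c.pt ◁ (λ_ (F.obj x)).hom

end Canonical

end WeakTannaka

set_option linter.unusedSectionVars false

/-! Transposing the projections of the end gives maps `E ⊗ F x ⟶ F x`, and the universal property of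
the end says that every natural family `X ⊗ F x ⟶ F x` comes from exactly one map `X ⟶ E`
(`IsUniversalAction`). Since `B` has duals, the same holds for families `X ⊗ F x ⟶ Y ⊗ F x` and maps
`X ⟶ Y ⊗ E` (`existsUnique_tensor`). Hence `E ⊗ E` acts faithfully on the objects `F x ⊗ F y`, and
`E ⊗ (E ⊗ E)` on `F x ⊗ (F y ⊗ F z)` (`JointlyFaithful.ten`). Structure maps can thus be defined,
and equations checked, by their effect on values of `F`.

Each axiom then becomes an identity about `F`. The element `Δ(1)` acts as the idempotent `μ ≫ δ`, so
the two weak unit axioms are the two Frobenius axioms, while multiplicativity of `Δ` is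
separability. The weak counit axioms hold because `k₁ ε(k₂ l)` and `k l` agree on the unit `𝟙 ⟶ F
𝟙`, which is all that the counit sees. For the antipode, `S ⋆ id` and `id ⋆ S` make an element act
on `F (Lx ⊗ x)` or `F (x ⊗ Lx)`; naturality moves the action along `ev` or `coev` to `F 𝟙`, and the
Frobenius axioms with the triangle identities recognise the result as the source or target map.

The coend form is the end form for `F.op : Aᵒᵖ ⥤ Bᵒᵖ`: separable Frobenius functors and weak Hopf
algebras are self-dual notions, and a coend in `B` acts universally in `Bᵒᵖ`. -/

namespace WeakTannaka

/-! ### Calculus of maps with a parameter in a braided monoidal category. -/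

section Parametrised

variable {C : Type u₂} [Category.{v₂} C] [MonoidalCategory C] [BraidedCategory C]

/-- A map `X ⊗ U ⟶ V`, regarded as a map `U ⟶ V` with parameter `X`, whiskered on the left: the
parameter passes over `W`. -/
def lft {X U V : C} (f : X ⊗ U ⟶ V) (W : C) : X ⊗ (W ⊗ U) ⟶ W ⊗ V :=
  (α_ X W U).inv ≫ (β_ X W).hom ▷ U ≫ (α_ W X U).hom ≫ W ◁ f

/-- A map `X ⊗ U ⟶ V`, regarded as a map `U ⟶ V` with parameter `X`, whiskered on the right. -/
def rgt {X U V : C} (f : X ⊗ U ⟶ V) (W : C) : X ⊗ (U ⊗ W) ⟶ V ⊗ W :=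
  (α_ X U W).inv ≫ f ▷ W

/-- The tensor product of two maps with parameters. -/
def ten {X Y U U' V V' : C} (f : X ⊗ U ⟶ V) (g : Y ⊗ U' ⟶ V') :
    (X ⊗ Y) ⊗ (U ⊗ U') ⟶ V ⊗ V' :=
  tensorμ X Y U U' ≫ (f ⊗ₘ g)

variable {X X' Y Y' Z U U' V V' W W' : C}

/-- The only crossing in `tensorμ` is that of `Y` over `U`, and `lft` contains it. This reduces
identities for `ten` to identities for one-sided whiskerings. -/
lemma ten_eq (f : X ⊗ U ⟶ V) (g : Y ⊗ U' ⟶ V') :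
    ten f g = (α_ X Y (U ⊗ U')).hom ≫ X ◁ lft g U ≫ rgt f V' := by
  simp only [ten, lft, rgt, tensorμ, tensorHom_def']
  monoidal

lemma param_lft (p : X' ⟶ X) (f : X ⊗ U ⟶ V) (W : C) :
    p ▷ (W ⊗ U) ≫ lft f W = lft (p ▷ U ≫ f) W := by
  simp only [lft, whiskerLeft_comp]
  rw [associator_inv_naturality_left_assoc, ← comp_whiskerRight_assoc,
    BraidedCategory.braiding_naturality_left]
  monoidal

lemma param_rgt (p : X' ⟶ X) (f : X ⊗ U ⟶ V) (W : C) :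
    p ▷ (U ⊗ W) ≫ rgt f W = rgt (p ▷ U ≫ f) W := by
  simp [rgt]

lemma param_ten (p : X' ⟶ X) (q : Y' ⟶ Y) (f : X ⊗ U ⟶ V) (g : Y ⊗ U' ⟶ V') :
    (p ⊗ₘ q) ▷ (U ⊗ U') ≫ ten f g = ten (p ▷ U ≫ f) (q ▷ U' ≫ g) := by
  simp only [ten, tensorμ_natural_left_assoc, tensorHom_comp_tensorHom]

lemma param_ten_left (p : X' ⟶ X) (f : X ⊗ U ⟶ V) (g : Y ⊗ U' ⟶ V') :
    (p ▷ Y) ▷ (U ⊗ U') ≫ ten f g = ten (p ▷ U ≫ f) g := by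
  simpa only [tensorHom_id, id_whiskerRight, Category.id_comp] using param_ten p (𝟙 Y) f g

lemma param_ten_right (p : Y' ⟶ Y) (f : X ⊗ U ⟶ V) (g : Y ⊗ U' ⟶ V') :
    (X ◁ p) ▷ (U ⊗ U') ≫ ten f g = ten f (p ▷ U' ≫ g) := by
  simpa only [id_tensorHom, id_whiskerRight, Category.id_comp] using param_ten (𝟙 X) p f g

lemma lft_comp (f : X ⊗ U ⟶ V) (h : V ⟶ V') (W : C) : lft (f ≫ h) W = lft f W ≫ W ◁ h := by
  simp [lft]

lemma rgt_comp (f : X ⊗ U ⟶ V) (h : V ⟶ V') (W : C) : rgt (f ≫ h) W = rgt f W ≫ h ▷ W := by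
  simp [rgt]

lemma ten_comp_left (f : X ⊗ U ⟶ V) (h : V ⟶ W) (g : Y ⊗ U' ⟶ V') :
    ten (f ≫ h) g = ten f g ≫ h ▷ V' := by
  simp [ten, ← tensorHom_id]

lemma ten_comp_right (f : X ⊗ U ⟶ V) (g : Y ⊗ U' ⟶ V') (h : V' ⟶ W) :
    ten f (g ≫ h) = ten f g ≫ V ◁ h := by
  simp [ten, ← id_tensorHom]

lemma lft_precomp (f : X ⊗ U ⟶ V) (h : U' ⟶ U) (W : C) :
    lft (X ◁ h ≫ f) W = X ◁ (W ◁ h) ≫ lft f W := by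
  simp only [lft, whiskerLeft_comp]
  rw [associator_inv_naturality_right_assoc, whisker_exchange_assoc]
  simp

lemma rgt_precomp (f : X ⊗ U ⟶ V) (h : U' ⟶ U) (W : C) :
    rgt (X ◁ h ≫ f) W = X ◁ (h ▷ W) ≫ rgt f W := by
  simp [rgt]

lemma ten_precomp (f : X ⊗ U ⟶ V) (h : W ⟶ U) (g : Y ⊗ U' ⟶ V') (h' : W' ⟶ U') :
    ten (X ◁ h ≫ f) (Y ◁ h' ≫ g) = (X ⊗ Y) ◁ (h ⊗ₘ h') ≫ ten f g := by
  simp only [ten, tensorμ_natural_right_assoc, tensorHom_comp_tensorHom]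

lemma ten_precomp_left (f : X ⊗ U ⟶ V) (h : W ⟶ U) (g : Y ⊗ U' ⟶ V') :
    ten (X ◁ h ≫ f) g = (X ⊗ Y) ◁ (h ▷ U') ≫ ten f g := by
  simpa only [tensorHom_id, whiskerLeft_id, Category.id_comp] using ten_precomp f h g (𝟙 U')

lemma ten_precomp_right (f : X ⊗ U ⟶ V) (g : Y ⊗ U' ⟶ V') (h : W ⟶ U') :
    ten f (Y ◁ h ≫ g) = (X ⊗ Y) ◁ (U ◁ h) ≫ ten f g := by
  simpa only [id_tensorHom, whiskerLeft_id, Category.id_comp] using ten_precomp f (𝟙 U) g h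

lemma lft_naturality (f : X ⊗ U ⟶ V) (h : W ⟶ W') :
    X ◁ (h ▷ U) ≫ lft f W' = lft f W ≫ h ▷ V := by
  simp only [lft, Category.assoc]
  rw [associator_inv_naturality_middle_assoc, ← comp_whiskerRight_assoc,
    BraidedCategory.braiding_naturality_right, whisker_exchange]
  simp

lemma rgt_naturality (f : X ⊗ U ⟶ V) (h : W ⟶ W') :
    X ◁ (U ◁ h) ≫ rgt f W' = rgt f W ≫ V ◁ h := by
  simp only [rgt, Category.assoc]
  rw [associator_inv_naturality_right_assoc, whisker_exchange]

lemma lft_unit (f : X ⊗ U ⟶ V) :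
    lft f (𝟙_ C) = X ◁ (λ_ U).hom ≫ f ≫ (λ_ V).inv := by
  simp only [lft, braiding_tensorUnit_right]
  monoidal

lemma rgt_unit (f : X ⊗ U ⟶ V) :
    rgt f (𝟙_ C) = X ◁ (ρ_ U).hom ≫ f ≫ (ρ_ V).inv := by
  simp only [rgt]
  monoidal

lemma lft_cmp (f : X ⊗ U ⟶ V) (g : Y ⊗ V ⟶ V') (W : C) :
    lft ((α_ Y X U).hom ≫ Y ◁ f ≫ g) W = (α_ Y X (W ⊗ U)).hom ≫ Y ◁ lft f W ≫ lft g W := by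
  simp only [lft, BraidedCategory.braiding_tensor_left_hom, whiskerLeft_comp, Category.assoc]
  rw [associator_inv_naturality_right_assoc, whisker_exchange_assoc]
  monoidal

lemma rgt_cmp (f : X ⊗ U ⟶ V) (g : Y ⊗ V ⟶ V') (W : C) :
    rgt ((α_ Y X U).hom ≫ Y ◁ f ≫ g) W = (α_ Y X (U ⊗ W)).hom ≫ Y ◁ rgt f W ≫ rgt g W := by
  simp only [rgt]
  monoidal

lemma lft_lft (f : X ⊗ U ⟶ V) (W W' : C) :
    lft (lft f W') W = X ◁ (α_ W W' U).inv ≫ lft f (W ⊗ W') ≫ (α_ W W' V).hom := by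
  simp only [lft, BraidedCategory.braiding_tensor_right_hom, whiskerLeft_comp, Category.assoc]
  monoidal

lemma lft_rgt (f : X ⊗ U ⟶ V) (W W' : C) :
    lft (rgt f W') W = X ◁ (α_ W U W').inv ≫ rgt (lft f W) W' ≫ (α_ W V W').hom := by
  simp only [rgt, lft]
  monoidal

/-- Whiskerings on different sides exchange, at the price of braiding the parameters. -/
lemma rgt_lft_exchange (f : X ⊗ U ⟶ V) (g : Y ⊗ U' ⟶ V') :
    (α_ Y X (U ⊗ U')).hom ≫ Y ◁ rgt f U' ≫ lft g V =
      (β_ Y X).hom ▷ (U ⊗ U') ≫ ten f g := by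
  rw [ten_eq]
  have h := BraidedCategory.braiding_naturality_right Y f
  rw [BraidedCategory.braiding_tensor_right_hom] at h
  simp only [rgt, lft, whiskerLeft_comp, Category.assoc]
  calc _ = 𝟙 _ ⊗≫ ((Y ◁ f ≫ (β_ Y V).hom) ▷ U') ⊗≫ V ◁ g := by monoidal
    _ = 𝟙 _ ⊗≫ (β_ Y X).hom ▷ (U ⊗ U') ⊗≫ X ◁ (β_ Y U).hom ▷ U' ⊗≫
          (f ▷ (Y ⊗ U') ≫ V ◁ g) := by rw [h]; monoidal
    _ = _ := by rw [← whisker_exchange]; monoidal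

lemma ten_rgt (a : X ⊗ U ⟶ V) (b : Y ⊗ U' ⟶ V') (W : C) :
    ten a (rgt b W) = (X ⊗ Y) ◁ (α_ U U' W).inv ≫ rgt (ten a b) W ≫ (α_ V V' W).hom := by
  simp only [ten_eq, lft_rgt]
  simp only [rgt]
  monoidal

lemma ten_lft_left (a : X ⊗ U ⟶ V) (b : Y ⊗ U' ⟶ V') (W : C) :
    ten (lft a W) b = (X ⊗ Y) ◁ (α_ W U U').hom ≫ lft (ten a b) W ≫ (α_ W V V').inv := by
  simp only [ten_eq, lft_cmp, lft_lft, lft_rgt]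
  monoidal

lemma ten_lft_right_eq (a : X ⊗ U ⟶ V) (b : Y ⊗ U' ⟶ V') (c : Z ⊗ V' ⟶ W) :
    ten a ((α_ Z Y U').hom ≫ Z ◁ b ≫ c) =
      (α_ X Z Y).inv ▷ (U ⊗ U') ≫ (α_ (X ⊗ Z) Y (U ⊗ U')).hom ≫ (X ⊗ Z) ◁ lft b U ≫ ten a c := by
  simp only [ten_eq, lft_cmp]
  monoidal

/-- An operator `c` performed after `ten a b` has to carry its parameter `Z` across `X` to join `Y`.
The resulting crossing is the one in the formula for the source map. -/
lemma ten_cmp_right (a : X ⊗ U ⟶ V) (b : Y ⊗ U' ⟶ V') (c : Z ⊗ V' ⟶ W) :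
    ((α_ Z X Y).inv ≫ (β_ Z X).hom ▷ Y ≫ (α_ X Z Y).hom) ▷ (U ⊗ U') ≫
        ten a ((α_ Z Y U').hom ≫ Z ◁ b ≫ c) =
      (α_ Z (X ⊗ Y) (U ⊗ U')).hom ≫ Z ◁ ten a b ≫ lft c V := by
  have h := rgt_lft_exchange a c
  simp only [ten_eq a b, whiskerLeft_comp, Category.assoc, ten_lft_right_eq]
  calc _ = 𝟙 _ ⊗≫ ((β_ Z X).hom ▷ (Y ⊗ (U ⊗ U')) ≫ (X ⊗ Z) ◁ lft b U) ≫ ten a c := by monoidal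
    _ = 𝟙 _ ⊗≫ (Z ⊗ X) ◁ lft b U ≫ ((β_ Z X).hom ▷ _ ≫ ten a c) := by
      rw [← whisker_exchange]; monoidal
    _ = _ := by rw [← h]; monoidal

lemma ten_cmp_left (a : X ⊗ U ⟶ V) (a' : X' ⊗ V ⟶ W) (b : Y ⊗ U' ⟶ V') :
    (α_ X' X Y).inv ▷ (U ⊗ U') ≫ ten ((α_ X' X U).hom ≫ X' ◁ a ≫ a') b =
      (α_ X' (X ⊗ Y) (U ⊗ U')).hom ≫ X' ◁ ten a b ≫ rgt a' V' := by
  simp only [ten_eq, rgt_cmp]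
  monoidal

/-- Here `a` is performed before `ten a' b`, so its parameter has to be crossed by `Y`. This
crossing occurs in the formulas for the target map and for `1₁ e ⊗ 1₂`. -/
lemma ten_cmp_left_braid (a : X ⊗ U ⟶ V) (a' : X' ⊗ V ⟶ W) (b : Y ⊗ U' ⟶ V') :
    ((α_ X' Y X).hom ≫ X' ◁ (β_ Y X).hom ≫ (α_ X' X Y).inv) ▷ (U ⊗ U') ≫
        ten ((α_ X' X U).hom ≫ X' ◁ a ≫ a') b =
      (α_ (X' ⊗ Y) X (U ⊗ U')).hom ≫ (X' ⊗ Y) ◁ rgt a U' ≫ ten a' b := by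
  have h := rgt_lft_exchange a b
  simp only [comp_whiskerRight, Category.assoc, ten_cmp_left]
  calc _ = 𝟙 _ ⊗≫ X' ◁ ((β_ Y X).hom ▷ (U ⊗ U') ≫ ten a b) ≫ rgt a' V' := by monoidal
    _ = _ := by rw [← h, ten_eq a' b]; monoidal

lemma ten_assoc (a : X ⊗ U ⟶ V) (b : Y ⊗ U' ⟶ V') (c : Z ⊗ W ⟶ W') :
    ten (ten a b) c ≫ (α_ V V' W').hom =
      (α_ X Y Z).hom ▷ _ ≫ (_ ◁ (α_ U U' W).hom) ≫ ten a (ten b c) := by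
  have h := associator_monoidal X Y Z U U' W
  have h₁ : ten a b ⊗ₘ c = tensorμ X Y U U' ▷ (Z ⊗ W) ≫ ((a ⊗ₘ b) ⊗ₘ c) := by
    rw [← tensorHom_id, tensorHom_comp_tensorHom, Category.id_comp, ten]
  have h₂ : a ⊗ₘ ten b c = (X ⊗ U) ◁ tensorμ Y Z U' W ≫ (a ⊗ₘ (b ⊗ₘ c)) := by
    rw [← id_tensorHom, tensorHom_comp_tensorHom, Category.id_comp, ten]
  rw [ten, h₁, ten, h₂, Category.assoc, Category.assoc, associator_naturality, reassoc_of% h,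
    MonoidalCategory.tensorHom_def, Category.assoc]

/-- The tensor product of maps with parameters is compatible with composition. -/
lemma ten_cmp (a : X ⊗ U ⟶ V) (a' : X' ⊗ V ⟶ W) (b : Y ⊗ U' ⟶ V') (b' : Y' ⊗ V' ⟶ W') :
    tensorμ X' Y' X Y ▷ (U ⊗ U') ≫
        ten ((α_ X' X U).hom ≫ X' ◁ a ≫ a') ((α_ Y' Y U').hom ≫ Y' ◁ b ≫ b') =
      (α_ (X' ⊗ Y') (X ⊗ Y) (U ⊗ U')).hom ≫ (X' ⊗ Y') ◁ ten a b ≫ ten a' b' := by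
  have h := tensor_associativity X' Y' X Y U U'
  simp only [ten, whiskerLeft_comp, Category.assoc]
  rw [← tensorHom_comp_tensorHom, reassoc_of% h, ← tensorHom_comp_tensorHom, ← id_tensorHom,
    ← id_tensorHom, tensorμ_natural_right_assoc, id_tensorHom, id_tensorHom]

end Parametrised

/-! ### Joint faithfulness and its stability under tensor products. -/

section Faithful

variable {B : Type u₂} [Category.{v₂} B] [MonoidalCategory B]

/-- A family of maps with parameter `Y` is jointly faithful if it detects equality of maps into
`Z ⊗ Y`, for every `Z`. -/
def JointlyFaithful {ι : Type*} {Y : B} {V W : ι → B} (a : ∀ i, Y ⊗ V i ⟶ W i) : Prop :=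
  ∀ ⦃X Z : B⦄ (f g : X ⟶ Z ⊗ Y), (∀ i, f ▷ V i ≫ (α_ Z Y (V i)).hom ≫ Z ◁ a i =
    g ▷ V i ≫ (α_ Z Y (V i)).hom ≫ Z ◁ a i) → f = g

lemma JointlyFaithful.hom_ext {ι : Type*} {Y : B} {V W : ι → B} {a : ∀ i, Y ⊗ V i ⟶ W i}
    (ha : JointlyFaithful a) {X : B} {f g : X ⟶ Y} (h : ∀ i, f ▷ V i ≫ a i = g ▷ V i ≫ a i) :
    f = g := by
  have := ha (f ≫ (λ_ Y).inv) (g ≫ (λ_ Y).inv) fun i => by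
    have e (f : X ⟶ Y) : (f ≫ (λ_ Y).inv) ▷ V i ≫ (α_ (𝟙_ B) Y (V i)).hom ≫ 𝟙_ B ◁ a i =
        (f ▷ V i ≫ a i) ≫ (λ_ _).inv := by monoidal
    rw [e, e, h]
  simpa using this

variable [BraidedCategory B]

/-- The two factors are removed one after the other. While one of them acts, the other is a
spectator, which is why joint faithfulness is required for maps into `Z ⊗ Y` with arbitrary `Z`. -/
lemma JointlyFaithful.ten {ι κ : Type*} {Y Y' : B} {V W : ι → B} {V' W' : κ → B}
    {a : ∀ i, Y ⊗ V i ⟶ W i} {b : ∀ j, Y' ⊗ V' j ⟶ W' j}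
    (ha : JointlyFaithful a) (hb : JointlyFaithful b) :
    JointlyFaithful (fun k : ι × κ => ten (a k.1) (b k.2)) := by
  intro X Z f g h
  -- Undoing the crossing of `Y'` over `W i` leaves `Y` next to `V i`, with `Z ⊗ Y'` as spectator,
  -- the form to which `ha` applies.
  have key (f : X ⟶ Z ⊗ (Y ⊗ Y')) (i : ι) : (f ▷ V i ≫ (α_ Z (Y ⊗ Y') (V i)).hom ≫
      Z ◁ ((α_ Y Y' (V i)).hom ≫ Y ◁ (β_ Y' (V i)).hom ≫ (α_ Y (V i) Y').inv ≫ a i ▷ Y') ≫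
        (α_ Z (W i) Y').inv) ≫ (α_ Z (W i) Y').hom ≫ Z ◁ (β_ Y' (W i)).inv ≫
          (α_ Z Y' (W i)).inv =
      (f ≫ Z ◁ (β_ Y' Y).inv ≫ (α_ Z Y' Y).inv) ▷ V i ≫ (α_ (Z ⊗ Y') Y (V i)).hom ≫
        (Z ⊗ Y') ◁ a i := by
    have n := BraidedCategory.braiding_inv_naturality_left (a i) Y'
    rw [BraidedCategory.braiding_tensor_right_inv] at n
    calc _ = 𝟙 _ ⊗≫ f ▷ V i ⊗≫ Z ◁ Y ◁ (β_ Y' (V i)).hom ⊗≫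
          Z ◁ (a i ▷ Y' ≫ (β_ Y' (W i)).inv) ⊗≫ 𝟙 _ := by monoidal
      _ = 𝟙 _ ⊗≫ f ▷ V i ⊗≫ Z ◁ Y ◁ ((β_ Y' (V i)).hom ≫ (β_ Y' (V i)).inv) ⊗≫
          Z ◁ (β_ Y' Y).inv ▷ V i ⊗≫ Z ◁ Y' ◁ a i ⊗≫ 𝟙 _ := by rw [n]; monoidal
      _ = _ := by rw [Iso.hom_inv_id]; monoidal
  have key' (f : X ⟶ Z ⊗ (Y ⊗ Y')) (i : ι) (j : κ) :
      (f ▷ V i ≫ (α_ Z (Y ⊗ Y') (V i)).hom ≫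
        Z ◁ ((α_ Y Y' (V i)).hom ≫ Y ◁ (β_ Y' (V i)).hom ≫ (α_ Y (V i) Y').inv ≫ a i ▷ Y') ≫
          (α_ Z (W i) Y').inv) ▷ V' j ≫ (α_ (Z ⊗ W i) Y' (V' j)).hom ≫ (Z ⊗ W i) ◁ b j =
      (α_ X (V i) (V' j)).hom ≫ (f ▷ (V i ⊗ V' j) ≫ (α_ Z (Y ⊗ Y') (V i ⊗ V' j)).hom ≫
        Z ◁ WeakTannaka.ten (a i) (b j)) ≫ (α_ Z (W i) (W' j)).inv := by
    simp only [WeakTannaka.ten, tensorμ, MonoidalCategory.tensorHom_def]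
    monoidal
  have h₁ (i : ι) := hb _ _ fun j => (key' f i j).trans <|
    .trans (congrArg (fun t => (α_ _ _ _).hom ≫ t ≫ (α_ _ _ _).inv) (h (i, j))) (key' g i j).symm
  have h₂ := ha (f ≫ Z ◁ (β_ Y' Y).inv ≫ (α_ Z Y' Y).inv)
    (g ≫ Z ◁ (β_ Y' Y).inv ≫ (α_ Z Y' Y).inv) fun i => by rw [← key, ← key, h₁ i]
  simpa only [← Category.assoc, cancel_mono] using h₂

end Faithful

/-! ### Universal actions and maps into `Y ⊗ E` and `E ⊗ E`. -/

section Universal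

variable {A : Type u₁} [Category.{v₁} A] {B : Type u₂} [Category.{v₂} B] [MonoidalCategory B]

/-- A natural action of `E` on the objects `F x` is universal if every natural family of maps
`X ⊗ F x ⟶ F x` is induced by a unique map `X ⟶ E`. -/
structure IsUniversalAction (F : A ⥤ B) {E : B} (a : ∀ x, E ⊗ F.obj x ⟶ F.obj x) : Prop where
  naturality ⦃x y : A⦄ (f : x ⟶ y) : E ◁ F.map f ≫ a y = a x ≫ F.map f
  existsUnique ⦃X : B⦄ (φ : ∀ x, X ⊗ F.obj x ⟶ F.obj x)
    (hφ : ∀ ⦃x y : A⦄ (f : x ⟶ y), X ◁ F.map f ≫ φ y = φ x ≫ F.map f) :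
    ∃! p : X ⟶ E, ∀ x, p ▷ F.obj x ≫ a x = φ x

variable {F : A ⥤ B} {E : B} {a : ∀ x, E ⊗ F.obj x ⟶ F.obj x}

namespace IsUniversalAction

/-- The dual of `Y` moves `Y` from the codomain to the parameter, which becomes `Yᘁ ⊗ X`; the
universal property applies there and the result is transposed back. -/
lemma existsUnique_tensor [RightRigidCategory B] (h : IsUniversalAction F a) {X Y : B}
    (φ : ∀ x, X ⊗ F.obj x ⟶ Y ⊗ F.obj x)
    (hφ : ∀ ⦃x y : A⦄ (f : x ⟶ y), X ◁ F.map f ≫ φ y = φ x ≫ Y ◁ F.map f) :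
    ∃! p : X ⟶ Y ⊗ E, ∀ x, p ▷ F.obj x ≫ (α_ Y E (F.obj x)).hom ≫ Y ◁ a x = φ x := by
  have key (q : Yᘁ ⊗ X ⟶ E) (x : A) :
      tensorLeftHomEquiv X Y (Yᘁ) E q ▷ F.obj x ≫ (α_ Y E (F.obj x)).hom ≫ Y ◁ a x =
      tensorLeftHomEquiv (X ⊗ F.obj x) Y (Yᘁ) (F.obj x) ((α_ _ _ _).inv ≫ q ▷ F.obj x ≫ a x) := by
    simp only [tensorLeftHomEquiv, Equiv.coe_fn_mk]
    monoidal
  obtain ⟨q, hq, hu⟩ := h.existsUnique (X := Yᘁ ⊗ X) (fun x => (α_ _ _ _).hom ≫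
    (tensorLeftHomEquiv (X ⊗ F.obj x) Y (Yᘁ) (F.obj x)).symm (φ x)) fun x y f => by
      rw [Category.assoc, tensor_whiskerLeft, Category.assoc, Category.assoc,
        Iso.inv_hom_id_assoc, ← tensorLeftHomEquiv_symm_naturality, hφ]
      congr 1
      rw [Equiv.symm_apply_eq, tensorLeftHomEquiv_naturality, Equiv.apply_symm_apply]
  refine ⟨tensorLeftHomEquiv X Y (Yᘁ) E q, fun x => ?_, fun p hp => ?_⟩
  · rw [key, hq, Iso.inv_hom_id_assoc, Equiv.apply_symm_apply]
  · rw [← Equiv.symm_apply_eq]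
    refine hu _ fun x => ?_
    rw [← hp x, ← Iso.inv_comp_eq, Equiv.eq_symm_apply, ← key, Equiv.apply_symm_apply]

lemma jointlyFaithful [RightRigidCategory B] (h : IsUniversalAction F a) : JointlyFaithful a := by
  intro X Z f g hfg
  refine (h.existsUnique_tensor (fun x => f ▷ F.obj x ≫ (α_ _ _ _).hom ≫ Z ◁ a x) ?_).unique
    (fun x => rfl) fun x => (hfg x).symm
  intro x y k
  rw [whisker_exchange_assoc, Category.assoc, Category.assoc, ← whiskerLeft_comp, ← h.naturality]
  simp

variable [BraidedCategory B]

/-- The universal property is used once in each variable: fixing `x` gives `g x : X ⊗ F x ⟶ F x ⊗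
E`, and this family is itself natural in `x`. -/
lemma exists_comul [RightRigidCategory B] (h : IsUniversalAction F a) {X : B}
    (φ : ∀ x y, X ⊗ (F.obj x ⊗ F.obj y) ⟶ F.obj x ⊗ F.obj y)
    (hl : ∀ ⦃x x' : A⦄ (f : x ⟶ x') (y : A),
      X ◁ (F.map f ▷ F.obj y) ≫ φ x' y = φ x y ≫ F.map f ▷ F.obj y)
    (hr : ∀ (x : A) ⦃y y' : A⦄ (f : y ⟶ y'),
      X ◁ (F.obj x ◁ F.map f) ≫ φ x y' = φ x y ≫ F.obj x ◁ F.map f) :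
    ∃ p : X ⟶ E ⊗ E, ∀ x y, p ▷ (F.obj x ⊗ F.obj y) ≫ ten (a x) (a y) = φ x y := by
  have hg (x : A) := (h.existsUnique_tensor (X := X ⊗ F.obj x) (Y := F.obj x)
    (fun y => (α_ _ _ _).hom ≫ φ x y) fun y y' f => by
      rw [Category.assoc, ← hr]; simp).exists
  choose g hg using hg
  have gnat ⦃x x' : A⦄ (f : x ⟶ x') :
      X ◁ F.map f ≫ g x' = g x ≫ F.map f ▷ E := by
    refine h.jointlyFaithful _ _ fun y => ?_
    have e₁ := hg x y
    have e₂ := hg x' y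
    calc _ = (X ◁ F.map f) ▷ F.obj y ≫ (g x' ▷ F.obj y ≫ (α_ _ _ _).hom ≫ F.obj x' ◁ a y) := by
          monoidal
      _ = (α_ _ _ _).hom ≫ X ◁ (F.map f ▷ F.obj y) ≫ φ x' y := by rw [e₂]; monoidal
      _ = (g x ▷ F.obj y ≫ (α_ _ _ _).hom ≫ F.obj x ◁ a y) ≫ F.map f ▷ F.obj y := by
          rw [hl, e₁, Category.assoc]
      _ = 𝟙 _ ⊗≫ g x ▷ F.obj y ⊗≫ (F.obj x ◁ a y ≫ F.map f ▷ F.obj y) := by monoidal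
      _ = _ := by rw [whisker_exchange]; monoidal
  obtain ⟨q, hq, -⟩ := h.existsUnique_tensor (X := X) (Y := E)
    (fun x => g x ≫ (β_ E (F.obj x)).inv) fun x x' f => by
      rw [← Category.assoc, gnat, Category.assoc, Category.assoc,
        BraidedCategory.braiding_inv_naturality_left]
  -- In `q` the second factor acts on `F x` and the first on `F y`, so the factors have to be
  -- exchanged.
  refine ⟨q ≫ (β_ E E).hom, fun x y => ?_⟩
  have e₂ := hq x
  rw [Iso.eq_comp_inv] at e₂
  have n := BraidedCategory.braiding_naturality_right E (a x)
  rw [BraidedCategory.braiding_tensor_right_hom] at n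
  rw [← cancel_epi (α_ X (F.obj x) (F.obj y)).hom, ← hg x y, ← e₂]
  simp only [ten, tensorμ, MonoidalCategory.tensorHom_def]
  calc _ = 𝟙 _ ⊗≫ q ▷ F.obj x ▷ F.obj y ⊗≫ (((α_ E E (F.obj x)).inv ≫
        (β_ E E).hom ▷ (F.obj x) ≫ (α_ E E (F.obj x)).hom ≫ E ◁ (β_ E (F.obj x)).hom ≫
        (α_ E (F.obj x) E).inv) ≫ a x ▷ E) ▷ F.obj y ⊗≫ F.obj x ◁ a y := by monoidal
    _ = _ := by
      rw [← n]; monoidal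

end IsUniversalAction

end Universal

/-! ### Reassociation and scalar-valued parameters. -/

section Units

variable {C : Type u₂} [Category.{v₂} C] [MonoidalCategory C] [BraidedCategory C]
  {X Y Z U U' V V' W W' : C}

lemma associator_param_ten (a : X ⊗ U ⟶ V) (b : Y ⊗ U' ⟶ V') (c : Z ⊗ W ⟶ W') :
    (α_ X Y Z).hom ▷ (U ⊗ (U' ⊗ W)) ≫ ten a (ten b c) =
      ((X ⊗ Y) ⊗ Z) ◁ (α_ U U' W).inv ≫ ten (ten a b) c ≫ (α_ V V' W').hom := by
  rw [ten_assoc, ← whisker_exchange_assoc, ← whiskerLeft_comp_assoc, Iso.inv_hom_id,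
    whiskerLeft_id, Category.id_comp]

/-- Evaluating a scalar-valued parameter on the right. -/
lemma whiskerLeft_scalar_param (a : X ⊗ U ⟶ V) {φ : Y ⟶ 𝟙_ C} {p : 𝟙_ C ⟶ U'}
    {g : Y ⊗ U' ⟶ V'} {q : V' ⟶ 𝟙_ C} (hφ : φ = (ρ_ Y).inv ≫ Y ◁ p ≫ g ≫ q) :
    (X ◁ φ ≫ (ρ_ X).hom) ▷ U ≫ a =
      (X ⊗ Y) ◁ ((ρ_ U).inv ≫ U ◁ p) ≫ ten a g ≫ V ◁ q ≫ (ρ_ V).hom := by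
  have e : Y ◁ p ≫ g ≫ q = φ ▷ (𝟙_ C) ≫ (λ_ (𝟙_ C)).hom := by
    rw [hφ]; monoidal
  rw [whiskerLeft_comp, Category.assoc, ← reassoc_of% @ten_comp_right, ← reassoc_of% @ten_precomp_right, e,
    ← reassoc_of% @param_ten_right, whisker_exchange_assoc]
  have : ten a (λ_ (𝟙_ C)).hom = ((ρ_ X).hom ⊗ₘ (ρ_ U).hom) ≫ a ≫ (ρ_ V).inv := by
    simp only [ten, tensorμ, braiding_tensorUnit_left]
    monoidal
  rw [this]
  monoidal

/-- Evaluating a scalar-valued parameter on the left. -/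
lemma whiskerRight_scalar_param (a : Y ⊗ U ⟶ V) {φ : X ⟶ 𝟙_ C} {p : 𝟙_ C ⟶ U'}
    {g : X ⊗ U' ⟶ V'} {q : V' ⟶ 𝟙_ C} (hφ : φ = (ρ_ X).inv ≫ X ◁ p ≫ g ≫ q) :
    (φ ▷ Y ≫ (λ_ Y).hom) ▷ U ≫ a =
      (X ⊗ Y) ◁ ((λ_ U).inv ≫ p ▷ U) ≫ ten g a ≫ q ▷ V ≫ (λ_ V).hom := by
  have e : X ◁ p ≫ g ≫ q = φ ▷ (𝟙_ C) ≫ (λ_ (𝟙_ C)).hom := by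
    rw [hφ]; monoidal
  rw [whiskerLeft_comp, Category.assoc, ← reassoc_of% @ten_comp_left, ← reassoc_of% @ten_precomp_left, e,
    ← reassoc_of% @param_ten_left, whisker_exchange_assoc]
  have : ten (λ_ (𝟙_ C)).hom a = ((λ_ Y).hom ⊗ₘ (λ_ U).hom) ≫ a ≫ (λ_ V).inv := by
    simp only [ten, tensorμ, braiding_tensorUnit_right]
    monoidal
  rw [this]
  monoidal

end Units

/-! ### Existence and uniqueness of the canonical structure maps. -/

section CanonicalData

variable {A : Type u₁} [Category.{v₁} A] [MonoidalCategory A]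
  {B : Type u₂} [Category.{v₂} B] [MonoidalCategory B] [BraidedCategory B]
  {F : A ⥤ B} [F.LaxMonoidal] [F.OplaxMonoidal] {E : B}

open Functor.LaxMonoidal Functor.OplaxMonoidal

/-- The effect of the antipode on `F x`, for a dual pair `x`, `y`. -/
def antipodeAction (a : ∀ x, E ⊗ F.obj x ⟶ F.obj x) (x y : A) [ExactPairing x y] :
    E ⊗ F.obj x ⟶ F.obj x :=
  E ◁ ((λ_ (F.obj x)).inv ≫ mapCoev F x y ▷ F.obj x ≫ (α_ _ _ _).hom) ≫
    lft (rgt (a y) (F.obj x)) (F.obj x) ≫ F.obj x ◁ mapEv F x y ≫ (ρ_ (F.obj x)).hom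

/-- The equations characterizing the canonical structure maps on an object acting on `F`. -/
structure IsCanonicalData [RightRigidCategory A] (a : ∀ x, E ⊗ F.obj x ⟶ F.obj x)
    (D : HopfData E) : Prop where
  one (x : A) : D.one ▷ F.obj x ≫ a x = (λ_ (F.obj x)).hom
  mul (x : A) : D.mul ▷ F.obj x ≫ a x = (α_ E E (F.obj x)).hom ≫ E ◁ a x ≫ a x
  counit : D.counit = (ρ_ E).inv ≫ E ◁ ε F ≫ a (𝟙_ A) ≫ η F
  comul (x y : A) : D.comul ▷ (F.obj x ⊗ F.obj y) ≫ ten (a x) (a y) =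
    E ◁ μ F x y ≫ a (x ⊗ y) ≫ δ F x y
  antipode (x : A) : D.antipode ▷ F.obj x ≫ a x = antipodeAction a x (xᘁ)

variable [RightRigidCategory A] {a : ∀ x, E ⊗ F.obj x ⟶ F.obj x}

/-- Dinaturality of `c_x`, inherited from `coev` by naturality of `δ`. With its counterpart for
`d_x` it makes the prescribed action of the antipode natural. -/
lemma mapCoev_rightAdjointMate {x y : A} (f : x ⟶ y) :
    mapCoev F x (xᘁ) ≫ F.map f ▷ F.obj (xᘁ) = mapCoev F y (yᘁ) ≫ F.obj y ◁ F.map (fᘁ) := by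
  simp only [mapCoev, Category.assoc, δ_natural_left, δ_natural_right]
  simp only [← F.map_comp_assoc, coevaluation_comp_rightAdjointMate]

lemma rightAdjointMate_mapEv {x y : A} (f : x ⟶ y) :
    F.map (fᘁ) ▷ F.obj x ≫ mapEv F x (xᘁ) = F.obj (yᘁ) ◁ F.map f ≫ mapEv F y (yᘁ) := by
  simp only [mapEv, μ_natural_left_assoc, μ_natural_right_assoc]
  simp only [← F.map_comp_assoc, rightAdjointMate_comp_evaluation]

/-- The morphism `f` is traded for `fᘁ` at the coevaluation, passes the action on the dual by
naturality there, and is traded back at the evaluation. -/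
lemma antipodeAction_naturality (h : IsUniversalAction F a) {x y : A} (f : x ⟶ y) :
    E ◁ F.map f ≫ antipodeAction a y (yᘁ) = antipodeAction a x (xᘁ) ≫ F.map f := by
  have e₁ : F.obj x ◁ mapEv F x (xᘁ) ≫ (ρ_ (F.obj x)).hom ≫ F.map f =
      F.map f ▷ (F.obj (xᘁ) ⊗ F.obj x) ≫ F.obj y ◁ mapEv F x (xᘁ) ≫ (ρ_ (F.obj y)).hom := by
    rw [← whisker_exchange_assoc]; monoidal
  have e₂ : ((λ_ (F.obj x)).inv ≫ mapCoev F x (xᘁ) ▷ F.obj x ≫ (α_ _ _ _).hom) ≫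
      F.map f ▷ (F.obj (xᘁ) ⊗ F.obj x) = (λ_ (F.obj x)).inv ≫ mapCoev F y (yᘁ) ▷ F.obj x ≫
        (α_ _ _ _).hom ≫ F.obj y ◁ (F.map (fᘁ) ▷ F.obj x) := by
    have := mapCoev_rightAdjointMate (F := F) f
    calc _ = 𝟙 _ ⊗≫ (mapCoev F x (xᘁ) ≫ F.map f ▷ F.obj (xᘁ)) ▷ F.obj x ⊗≫ 𝟙 _ := by monoidal
      _ = _ := by rw [this]; monoidal
  have e₃ : F.map f ≫ (λ_ (F.obj y)).inv ≫ mapCoev F y (yᘁ) ▷ F.obj y ≫ (α_ _ _ _).hom =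
      (λ_ (F.obj x)).inv ≫ mapCoev F y (yᘁ) ▷ F.obj x ≫ (α_ _ _ _).hom ≫
        F.obj y ◁ (F.obj (yᘁ) ◁ F.map f) := by
    rw [leftUnitor_inv_naturality_assoc, whisker_exchange_assoc]
    simp
  symm
  simp only [antipodeAction, Category.assoc]
  rw [e₁, ← reassoc_of% @lft_naturality, ← whiskerLeft_comp_assoc, e₂]
  simp only [whiskerLeft_comp, Category.assoc]
  rw [← reassoc_of% @lft_precomp, ← rgt_precomp, h.naturality, rgt_comp, lft_comp, Category.assoc,
    ← whiskerLeft_comp_assoc (F.obj y), rightAdjointMate_mapEv, whiskerLeft_comp_assoc, ← reassoc_of% @lft_comp,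
    ← rgt_naturality, lft_precomp]
  simp only [← whiskerLeft_comp_assoc, Category.assoc, e₃]

variable [RightRigidCategory B]

/-- The prescribed actions are natural, hence realised by maps; the counit is given outright.
Uniqueness is faithfulness of the actions of `E` and, for the comultiplication, of `E ⊗ E`. -/
theorem existsUnique_isCanonicalData (h : IsUniversalAction F a) :
    ∃! D : HopfData E, IsCanonicalData a D := by
  obtain ⟨one, h₁, -⟩ := h.existsUnique (fun x => (λ_ (F.obj x)).hom) 
    fun x y f => leftUnitor_naturality _
  obtain ⟨mul, h₂, -⟩ := h.existsUnique
    (fun x => (α_ E E (F.obj x)).hom ≫ E ◁ a x ≫ a x) fun x y f => by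
      simp only [Category.assoc, ← h.naturality, tensor_whiskerLeft, Iso.inv_hom_id_assoc]
      rw [← whiskerLeft_comp_assoc, h.naturality, whiskerLeft_comp_assoc, h.naturality]
  obtain ⟨comul, h₃⟩ := h.exists_comul (fun x y => E ◁ μ F x y ≫ a (x ⊗ y) ≫ δ F x y)
    (fun x x' f y => by
      simp only [← whiskerLeft_comp_assoc, Category.assoc, μ_natural_left, δ_natural_left]
      simp only [whiskerLeft_comp_assoc, reassoc_of% h.naturality])
    (fun x y y' f => by
      simp only [← whiskerLeft_comp_assoc, Category.assoc, μ_natural_right, δ_natural_right]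
      simp only [whiskerLeft_comp_assoc, reassoc_of% h.naturality])
  obtain ⟨antipode, h₄, -⟩ := h.existsUnique (fun x => antipodeAction a x (xᘁ))
    fun x y f => antipodeAction_naturality h f
  have J := h.jointlyFaithful
  refine ⟨⟨one, mul, _, comul, antipode⟩, ⟨h₁, h₂, rfl, h₃, h₄⟩, fun D hD => ?_⟩
  ext
  · exact J.hom_ext fun x => by rw [hD.one, h₁]
  · exact J.hom_ext fun x => by rw [hD.mul, h₂]
  · exact hD.counit
  · exact (J.ten J).hom_ext fun x => by rw [hD.comul, h₃]
  · exact J.hom_ext fun x => by rw [hD.antipode, h₄]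

end CanonicalData

/-! ### Monoid and comonoid axioms, and multiplicativity of the comultiplication. -/

section WeakBialgebra

variable {A : Type u₁} [Category.{v₁} A] [MonoidalCategory A]
  {B : Type u₂} [Category.{v₂} B] [MonoidalCategory B] [BraidedCategory B]
  {F : A ⥤ B} [F.LaxMonoidal] [F.OplaxMonoidal] {E : B}

open Functor.LaxMonoidal Functor.OplaxMonoidal

variable [RightRigidCategory A] {a : ∀ x, E ⊗ F.obj x ⟶ F.obj x} {D : HopfData E}

namespace IsCanonicalData

variable [RightRigidCategory B] [IsSeparableFrobenius F] (hD : IsCanonicalData a D) (h : IsUniversalAction F a)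
include hD

/-- As `1` acts trivially on `F (x ⊗ y)`, only the idempotent `μ ≫ δ` is left. Its failure to be the
identity is what makes the bialgebra weak. -/
lemma one_comul (x y : A) : (D.one ≫ D.comul) ▷ (F.obj x ⊗ F.obj y) ≫ ten (a x) (a y) =
    (λ_ _).hom ≫ μ F x y ≫ δ F x y := by
  rw [comp_whiskerRight, Category.assoc, hD.comul, ← whisker_exchange_assoc, reassoc_of% hD.one]
  simp only [id_whiskerLeft, Category.assoc, Iso.inv_hom_id_assoc]

/-- This has the shape of the hypothesis `hφ` in `whiskerLeft_scalar_param` and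
`whiskerRight_scalar_param`, so that factors `ε(h k)` can be evaluated. -/
lemma mul_counit : D.mul ≫ D.counit = (ρ_ _).inv ≫ (E ⊗ E) ◁ ε F ≫
    ((α_ E E _).hom ≫ E ◁ a (𝟙_ A) ≫ a (𝟙_ A)) ≫ η F := by
  rw [hD.counit, rightUnitor_inv_naturality_assoc, ← whisker_exchange_assoc, reassoc_of% hD.mul]
  simp only [Category.assoc]

include h

lemma one_mul : D.one ▷ E ≫ D.mul = (λ_ E).hom :=
  h.jointlyFaithful.hom_ext fun x => by
    rw [comp_whiskerRight, Category.assoc, hD.mul, associator_naturality_left_assoc,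
      ← whisker_exchange_assoc, hD.one]
    monoidal

lemma mul_one : E ◁ D.one ≫ D.mul = (ρ_ E).hom :=
  h.jointlyFaithful.hom_ext fun x => by
    rw [comp_whiskerRight, Category.assoc, hD.mul, associator_naturality_middle_assoc,
      ← whiskerLeft_comp_assoc, hD.one]
    monoidal

lemma mul_associative : D.mul ▷ E ≫ D.mul = (α_ E E E).hom ≫ E ◁ D.mul ≫ D.mul :=
  h.jointlyFaithful.hom_ext fun x => by
    simp only [comp_whiskerRight, Category.assoc]
    rw [hD.mul, associator_naturality_left_assoc, ← whisker_exchange_assoc, hD.mul,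
      associator_naturality_middle_assoc, ← whiskerLeft_comp_assoc, hD.mul]
    monoidal

lemma counit_comul : D.comul ≫ D.counit ▷ E = (λ_ E).inv := by
  rw [← Iso.comp_hom_eq_id, Category.assoc]
  refine h.jointlyFaithful.hom_ext fun x => ?_
  have e : F.map (λ_ x).inv ≫ δ F (𝟙_ A) x ≫ η F ▷ F.obj x ≫ (λ_ (F.obj x)).hom = 𝟙 _ := by
    simp only [← Category.assoc, Iso.comp_hom_eq_id]
    simp only [Category.assoc, ← Functor.OplaxMonoidal.left_unitality]
  rw [comp_whiskerRight, Category.assoc, whiskerRight_scalar_param _ hD.counit,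
    ← whisker_exchange_assoc, reassoc_of% hD.comul, ← whiskerLeft_comp_assoc, Category.assoc,
    left_unitality_inv, reassoc_of% h.naturality, e, Category.comp_id, id_whiskerRight, Category.id_comp]

lemma comul_counit : D.comul ≫ E ◁ D.counit = (ρ_ E).inv := by
  rw [← Iso.comp_hom_eq_id, Category.assoc]
  refine h.jointlyFaithful.hom_ext fun x => ?_
  have e : F.map (ρ_ x).inv ≫ δ F x (𝟙_ A) ≫ F.obj x ◁ η F ≫ (ρ_ (F.obj x)).hom = 𝟙 _ := by
    simp only [← Category.assoc, Iso.comp_hom_eq_id]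
    simp only [Category.assoc, ← Functor.OplaxMonoidal.right_unitality]
  rw [comp_whiskerRight, Category.assoc, whiskerLeft_scalar_param _ hD.counit,
    ← whisker_exchange_assoc, reassoc_of% hD.comul, ← whiskerLeft_comp_assoc, Category.assoc,
    right_unitality_inv, reassoc_of% h.naturality, e, Category.comp_id, id_whiskerRight, Category.id_comp]

/-- Both sides act through `F` of a threefold tensor product; associativity of `μ` and `δ`, with
naturality of the action along the associator, compares the bracketings. -/
lemma coassoc : D.comul ≫ E ◁ D.comul = D.comul ≫ D.comul ▷ E ≫ (α_ E E E).hom := by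
  refine (h.jointlyFaithful.ten (h.jointlyFaithful.ten h.jointlyFaithful)).hom_ext fun i => ?_
  obtain ⟨x, y, z⟩ := i
  simp only [comp_whiskerRight, Category.assoc, associator_param_ten]
  rw [param_ten_right, hD.comul, ten_precomp_right, ten_comp_right, ← whisker_exchange_assoc,
    reassoc_of% hD.comul, ← whisker_exchange_assoc, reassoc_of% @param_ten_left, hD.comul,
    reassoc_of% @ten_precomp_left, reassoc_of% @ten_comp_left, ← whisker_exchange_assoc, ← whisker_exchange_assoc,
    reassoc_of% hD.comul, ← whiskerLeft_comp_assoc, ← whiskerLeft_comp_assoc, ← whiskerLeft_comp_assoc,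
    Functor.OplaxMonoidal.associativity, ← reassoc_of% h.naturality, ← whiskerLeft_comp_assoc]
  simp

/-- On `F x ⊗ F y` the right side acts as two composites `μ ≫ action ≫ δ` in succession;
separability cancels the `δ ≫ μ` between them. -/
lemma mul_comul : D.mul ≫ D.comul =
    (D.comul ⊗ₘ D.comul) ≫ tensorμ E E E E ≫ (D.mul ⊗ₘ D.mul) := by
  refine (h.jointlyFaithful.ten h.jointlyFaithful).hom_ext fun i => ?_
  obtain ⟨x, y⟩ := i
  simp only [comp_whiskerRight, Category.assoc]
  rw [hD.comul, param_ten, hD.mul, hD.mul, ten_cmp, ← whisker_exchange_assoc, reassoc_of% hD.mul,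
    MonoidalCategory.tensorHom_def, comp_whiskerRight, Category.assoc,
    associator_naturality_middle_assoc, associator_naturality_left_assoc, ← whiskerLeft_comp_assoc,
    hD.comul, ← whisker_exchange_assoc, hD.comul]
  simp only [whiskerLeft_comp_assoc]
  rw [← whiskerLeft_comp_assoc E (δ F x y), IsSeparableFrobenius.separable, whiskerLeft_id,
    Category.id_comp, associator_naturality_right_assoc]

end IsCanonicalData

end WeakBialgebra

/-! ### The weak unit and weak counit axioms. -/

section WeakUnitCounit

variable {A : Type u₁} [Category.{v₁} A] [MonoidalCategory A]
  {B : Type u₂} [Category.{v₂} B] [MonoidalCategory B] [BraidedCategory B]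
  {F : A ⥤ B} [F.LaxMonoidal] [F.OplaxMonoidal] {E : B}

open Functor.LaxMonoidal Functor.OplaxMonoidal

/-- Braiding a element across `E` undoes the inverse braiding. -/
lemma unit_braiding_mul (u : 𝟙_ B ⟶ E ⊗ E) (m : E ⊗ E ⟶ E) :
    (ρ_ E).inv ≫ E ◁ u ≫ (α_ E E E).inv ≫ ((β_ E E).inv ≫ m) ▷ E =
      (λ_ E).inv ≫ u ▷ E ≫ ((α_ E E E).hom ≫ E ◁ (β_ E E).hom ≫ (α_ E E E).inv) ≫ m ▷ E := by
  have e := BraidedCategory.braiding_naturality_left u E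
  rw [braiding_tensorUnit_left, BraidedCategory.braiding_tensor_left_hom] at e
  have e' : (ρ_ E).inv ≫ E ◁ u = (λ_ E).inv ≫ u ▷ E ≫ (α_ E E E).hom ≫ E ◁ (β_ E E).hom ≫
      (α_ E E E).inv ≫ (β_ E E).hom ▷ E ≫ (α_ E E E).hom := by
    rw [e]; simp
  rw [reassoc_of% e']
  simp

/-- Braiding a scalar-valued map across `E` undoes the inverse braiding. -/
lemma counit_braiding_comul (φ : E ⊗ E ⟶ 𝟙_ B) (d : E ⟶ E ⊗ E) :
    (d ≫ (β_ E E).inv) ▷ E ≫ (α_ E E E).hom ≫ E ◁ φ ≫ (ρ_ E).hom =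
      d ▷ E ≫ ((α_ E E E).hom ≫ E ◁ (β_ E E).hom ≫ (α_ E E E).inv) ≫ φ ▷ E ≫ (λ_ E).hom := by
  have e := BraidedCategory.braiding_naturality_right E φ
  rw [braiding_tensorUnit_right, BraidedCategory.braiding_tensor_right_hom] at e
  have e' : E ◁ φ ≫ (ρ_ E).hom = (α_ E E E).inv ≫ (β_ E E).hom ▷ E ≫ (α_ E E E).hom ≫
      E ◁ (β_ E E).hom ≫ (α_ E E E).inv ≫ φ ▷ E ≫ (λ_ E).hom := by
    rw [← Category.assoc, Iso.comp_inv_eq] at e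
    rw [e]
    simp
  rw [e']
  simp

lemma counit_unit_left (x : A) :
    F.map (λ_ x).inv ≫ δ F (𝟙_ A) x ≫ η F ▷ F.obj x ≫ (λ_ (F.obj x)).hom = 𝟙 _ := by
  simp only [← Category.assoc, Iso.comp_hom_eq_id]
  simp only [Category.assoc, ← Functor.OplaxMonoidal.left_unitality]

lemma counit_unit_right (x : A) :
    F.map (ρ_ x).inv ≫ δ F x (𝟙_ A) ≫ F.obj x ◁ η F ≫ (ρ_ (F.obj x)).hom = 𝟙 _ := by
  simp only [← Category.assoc, Iso.comp_hom_eq_id]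
  simp only [Category.assoc, ← Functor.OplaxMonoidal.right_unitality]

lemma unit_unit_exchange : ε F ≫ (ρ_ (F.obj (𝟙_ A))).inv ≫ F.obj (𝟙_ A) ◁ ε F =
    ε F ≫ (λ_ (F.obj (𝟙_ A))).inv ≫ ε F ▷ F.obj (𝟙_ A) := by
  rw [rightUnitor_inv_naturality_assoc, ← whisker_exchange]
  monoidal

variable [RightRigidCategory A] {a : ∀ x, E ⊗ F.obj x ⟶ F.obj x} {D : HopfData E}

namespace IsCanonicalData

variable [RightRigidCategory B] [IsSeparableFrobenius F] (hD : IsCanonicalData a D)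
  (h : IsUniversalAction F a)
include hD

/-- The action of `e ↦ e 1₁ ⊗ 1₂`. -/
lemma mul_one_comul_action (y z : A) :
    ((ρ_ E).inv ≫ E ◁ (D.one ≫ D.comul) ≫ (α_ E E E).inv ≫ D.mul ▷ E) ▷ (F.obj y ⊗ F.obj z) ≫
      ten (a y) (a z) = E ◁ (μ F y z ≫ δ F y z) ≫ rgt (a y) (F.obj z) := by
  simp only [comp_whiskerRight, Category.assoc]
  rw [param_ten_left, hD.mul, ten_cmp_left, associator_naturality_middle_assoc,
    ← whiskerLeft_comp_assoc E ((D.one ≫ D.comul) ▷ _), hD.one_comul]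
  monoidal

/-- The action of `e ↦ 1₁ e ⊗ 1₂`, where `1₂` passes over `e`. -/
lemma one_comul_mul_action (y z : A) :
    ((λ_ E).inv ≫ (D.one ≫ D.comul) ▷ E ≫ ((α_ E E E).hom ≫ E ◁ (β_ E E).hom ≫
      (α_ E E E).inv) ≫ D.mul ▷ E) ▷ (F.obj y ⊗ F.obj z) ≫
      ten (a y) (a z) = rgt (a y) (F.obj z) ≫ μ F y z ≫ δ F y z := by
  rw [comp_whiskerRight, comp_whiskerRight (_ ▷ E), comp_whiskerRight ((α_ E E E).hom ≫ _),
    Category.assoc, Category.assoc, Category.assoc, param_ten_left, hD.mul, ten_cmp_left_braid, associator_naturality_left_assoc,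
    ← whisker_exchange_assoc, hD.one_comul]
  simp only [rgt]
  monoidal

/-- The action of `1₁ ⊗ 1₂ e`-type elements of `E ⊗ (E ⊗ E)`. -/
lemma one_comul_whiskerLeft_action (x y z : A) {v : E ⟶ E ⊗ E}
    {k k' : F.obj y ⊗ F.obj z ⟶ F.obj y ⊗ F.obj z}
    (hv : v ▷ (F.obj y ⊗ F.obj z) ≫ ten (a y) (a z) = E ◁ k ≫ rgt (a y) (F.obj z) ≫ k') :
    ((D.one ≫ D.comul) ≫ E ◁ v) ▷ (F.obj x ⊗ (F.obj y ⊗ F.obj z)) ≫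
      ten (a x) (ten (a y) (a z)) = (λ_ _).hom ≫ F.obj x ◁ k ≫ (α_ _ _ _).inv ≫
        (μ F x y ≫ δ F x y) ▷ F.obj z ≫ (α_ _ _ _).hom ≫ F.obj x ◁ k' := by
  rw [comp_whiskerRight, Category.assoc, param_ten_right, hv, ten_precomp_right, ten_comp_right,
    ten_rgt, ← whisker_exchange_assoc]
  simp only [Category.assoc]
  rw [← whisker_exchange_assoc, reassoc_of% @param_rgt, hD.one_comul]
  simp only [rgt]
  monoidal

include h

/-- In both weak unit axioms the right side is `Δ(1)` with `v` applied to its second leg, where `v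
e` is `e 1₁ ⊗ 1₂` or `1₁ e ⊗ 1₂`. After coassociativity the left side acts by merging all three
factors and splitting them again. -/
lemma one_comul_comul_aux {v : E ⟶ E ⊗ E}
    (hv : ∀ x y z, ((D.one ≫ D.comul) ≫ E ◁ v) ▷ (F.obj x ⊗ (F.obj y ⊗ F.obj z)) ≫
      ten (a x) (ten (a y) (a z)) = (λ_ _).hom ≫ F.obj x ◁ μ F y z ≫ μ F x (y ⊗ z) ≫
        δ F x (y ⊗ z) ≫ F.obj x ◁ δ F y z) :
    D.one ≫ D.comul ≫ D.comul ▷ E = (D.one ≫ D.comul) ≫ E ◁ v ≫ (α_ E E E).inv := by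
  rw [← cancel_mono (α_ E E E).hom]
  simp only [Category.assoc, Iso.inv_hom_id, Category.comp_id]
  rw [← hD.coassoc h]
  refine (h.jointlyFaithful.ten (h.jointlyFaithful.ten h.jointlyFaithful)).hom_ext fun i => ?_
  obtain ⟨x, y, z⟩ := i
  have := hv x y z
  rw [Category.assoc] at this
  rw [this, ← Category.assoc, comp_whiskerRight, Category.assoc, param_ten_right, hD.comul,
    ten_precomp_right, ten_comp_right, ← whisker_exchange_assoc, reassoc_of% hD.one_comul]
  simp

/-- The idempotent on `F y ⊗ F z` is applied before the one on `F x ⊗ F y`; the `δ` of the former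
and the `μ` of the latter meet as in `frobenius_right`. -/
lemma one_comul_comul : D.one ≫ D.comul ≫ D.comul ▷ E =
    (λ_ (𝟙_ B)).inv ≫ ((D.one ≫ D.comul) ⊗ₘ (D.one ≫ D.comul)) ⊗≫
      E ◁ D.mul ▷ E ≫ (α_ E E E).inv := by
  refine (hD.one_comul_comul_aux h fun x y z => (hD.one_comul_whiskerLeft_action x y z (k' := 𝟙 _)
    ((hD.mul_one_comul_action y z).trans (by rw [Category.comp_id]))).trans ?_).trans ?_
  · have e := IsSeparableFrobenius.frobenius_right (F := F) x y z
    have e' := Functor.OplaxMonoidal.associativity F x y z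
    simp only [whiskerLeft_comp, comp_whiskerRight, Category.assoc, whiskerLeft_id,
      Category.comp_id]
    rw [reassoc_of% e, e', ← F.map_comp_assoc]
    simp
  · rw [MonoidalCategory.tensorHom_def]
    monoidal

/-- Now the idempotent on `F x ⊗ F y` comes first, so `frobenius_left` is the axiom needed. -/
lemma one_comul_comul' : D.one ≫ D.comul ≫ D.comul ▷ E =
    (λ_ (𝟙_ B)).inv ≫ ((D.one ≫ D.comul) ⊗ₘ (D.one ≫ D.comul)) ⊗≫
      E ◁ ((β_ E E).inv ≫ D.mul) ▷ E ≫ (α_ E E E).inv := by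
  refine (hD.one_comul_comul_aux h fun x y z => (hD.one_comul_whiskerLeft_action x y z (k := 𝟙 _)
    ((hD.one_comul_mul_action y z).trans (by rw [whiskerLeft_id, Category.id_comp]))).trans
      ?_).trans ?_
  · have e := IsSeparableFrobenius.frobenius_left (F := F) x y z
    have e' := Functor.LaxMonoidal.associativity F x y z
    simp only [whiskerLeft_comp, comp_whiskerRight, Category.assoc, whiskerLeft_id,
      Category.id_comp]
    rw [reassoc_of% e, reassoc_of% e']
    simp
  · rw [← unit_braiding_mul, MonoidalCategory.tensorHom_def]
    monoidal

omit h

/-- The counit of a product `h w` depends on `w` only through its action on the unit `𝟙 ⟶ F 𝟙`, so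
the weak counit axioms need only be compared there. -/
lemma mul_mul_counit_aux {w : E ⊗ E ⟶ E}
    (hw : (E ⊗ E) ◁ ε F ≫ w ▷ F.obj (𝟙_ A) ≫ a (𝟙_ A) =
      (E ⊗ E) ◁ ε F ≫ (α_ _ _ _).hom ≫ E ◁ a (𝟙_ A) ≫ a (𝟙_ A)) :
    E ◁ w ≫ D.mul ≫ D.counit = E ◁ D.mul ≫ D.mul ≫ D.counit := by
  have e (w : E ⊗ E ⟶ E) : E ◁ w ≫ D.mul ≫ D.counit = 𝟙 _ ⊗≫
      E ◁ ((E ⊗ E) ◁ ε F ≫ w ▷ F.obj (𝟙_ A) ≫ a (𝟙_ A)) ≫ a (𝟙_ A) ≫ η F := by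
    rw [hD.mul_counit, rightUnitor_inv_naturality_assoc, ← whisker_exchange_assoc]
    monoidal
  rw [e, e, hw, hD.mul]

include h

/-- The element `k₁ ε(k₂ l)` acts on the unit like `k l`. -/
lemma comul_mul_counit_action :
    (E ⊗ E) ◁ ε F ≫ (D.comul ▷ E ≫ (α_ E E E).hom ≫ E ◁ (D.mul ≫ D.counit) ≫
      (ρ_ E).hom) ▷ F.obj (𝟙_ A) ≫ a (𝟙_ A) =
      (E ⊗ E) ◁ ε F ≫ (α_ _ _ _).hom ≫ E ◁ a (𝟙_ A) ≫ a (𝟙_ A) := by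
  -- Two copies of the unit may be created in either order, so the one left of `l` can be created
  -- after `l` has acted.
  have e₁ : E ◁ (ε F ≫ (ρ_ _).inv ≫ F.obj (𝟙_ A) ◁ ε F) ≫ lft (a (𝟙_ A)) (F.obj (𝟙_ A)) =
      E ◁ ε F ≫ a (𝟙_ A) ≫ (λ_ _).inv ≫ ε F ▷ F.obj (𝟙_ A) := by
    rw [unit_unit_exchange, whiskerLeft_comp, whiskerLeft_comp, Category.assoc, Category.assoc,
      lft_naturality, lft_unit]
    monoidal
  have e₂ := counit_unit_right (F := F) (𝟙_ A)
  -- Unitality of `μ` produces a left unitor and counitality of `δ` a right one; they cancel because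
  -- both agree at the unit object.
  rw [← unitors_inv_equal] at e₂
  rw [comp_whiskerRight, comp_whiskerRight, Category.assoc, Category.assoc,
    whiskerLeft_scalar_param _ hD.mul_counit, ten_lft_right_eq]
  calc _ = (E ⊗ E) ◁ ε F ≫ ((D.comul ▷ E) ▷ F.obj (𝟙_ A) ≫ (α_ E E E).hom ▷ F.obj (𝟙_ A) ≫
          (E ⊗ E ⊗ E) ◁ ((ρ_ _).inv ≫ F.obj (𝟙_ A) ◁ ε F)) ≫ (α_ E E E).inv ▷ _ ≫
          (α_ _ _ _).hom ≫ (E ⊗ E) ◁ lft (a (𝟙_ A)) (F.obj (𝟙_ A)) ≫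
          ten (a (𝟙_ A)) (a (𝟙_ A)) ≫ F.obj (𝟙_ A) ◁ η F ≫ (ρ_ _).hom := by
        simp only [Category.assoc]
    _ = (E ⊗ E) ◁ (ε F ≫ (ρ_ _).inv ≫ F.obj (𝟙_ A) ◁ ε F) ≫ (α_ _ _ _).hom ≫
          (D.comul ▷ _ ≫ (E ⊗ E) ◁ lft (a (𝟙_ A)) (F.obj (𝟙_ A))) ≫
          ten (a (𝟙_ A)) (a (𝟙_ A)) ≫ F.obj (𝟙_ A) ◁ η F ≫ (ρ_ _).hom := by
        rw [← whisker_exchange, ← whisker_exchange_assoc]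
        monoidal
    _ = 𝟙 _ ⊗≫ E ◁ (E ◁ (ε F ≫ (ρ_ _).inv ≫ F.obj (𝟙_ A) ◁ ε F) ≫
          lft (a (𝟙_ A)) (F.obj (𝟙_ A))) ≫ E ◁ μ F (𝟙_ A) (𝟙_ A) ≫ a (𝟙_ A ⊗ 𝟙_ A) ≫
          δ F (𝟙_ A) (𝟙_ A) ≫ F.obj (𝟙_ A) ◁ η F ≫ (ρ_ _).hom := by
        rw [← whisker_exchange, Category.assoc, reassoc_of% hD.comul]
        monoidal
    _ = 𝟙 _ ⊗≫ E ◁ (E ◁ ε F ≫ a (𝟙_ A)) ≫ (E ◁ F.map (λ_ (𝟙_ A)).inv ≫ a (𝟙_ A ⊗ 𝟙_ A)) ≫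
          δ F (𝟙_ A) (𝟙_ A) ≫ F.obj (𝟙_ A) ◁ η F ≫ (ρ_ _).hom := by
        rw [e₁, ← left_unitality_inv]
        monoidal
    _ = _ := by
        rw [h.naturality, Category.assoc, e₂]
        monoidal

/-- The element `ε(k₁ l) k₂`, where `k₂` passes over `l`, acts on the unit like `k l`. -/
lemma comul_mul_counit_action' :
    (E ⊗ E) ◁ ε F ≫ (D.comul ▷ E ≫ ((α_ E E E).hom ≫ E ◁ (β_ E E).hom ≫ (α_ E E E).inv) ≫
      (D.mul ≫ D.counit) ▷ E ≫ (λ_ E).hom) ▷ F.obj (𝟙_ A) ≫ a (𝟙_ A) =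
      (E ⊗ E) ◁ ε F ≫ (α_ _ _ _).hom ≫ E ◁ a (𝟙_ A) ≫ a (𝟙_ A) := by
  have e₁ : E ◁ (ε F ≫ (λ_ _).inv ≫ ε F ▷ F.obj (𝟙_ A)) ≫ rgt (a (𝟙_ A)) (F.obj (𝟙_ A)) =
      E ◁ ε F ≫ a (𝟙_ A) ≫ (ρ_ _).inv ≫ F.obj (𝟙_ A) ◁ ε F := by
    rw [← unit_unit_exchange, whiskerLeft_comp, whiskerLeft_comp, Category.assoc, Category.assoc,
      rgt_naturality, rgt_unit]
    monoidal
  have e₂ := counit_unit_left (F := F) (𝟙_ A)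
  rw [unitors_inv_equal] at e₂
  rw [comp_whiskerRight, comp_whiskerRight (_ ≫ _ ≫ _), Category.assoc, Category.assoc,
    whiskerRight_scalar_param _ hD.mul_counit]
  calc _ = (E ⊗ E) ◁ ε F ≫ ((D.comul ▷ E) ▷ F.obj (𝟙_ A) ≫ ((α_ E E E).hom ≫ E ◁ (β_ E E).hom ≫
          (α_ E E E).inv) ▷ F.obj (𝟙_ A) ≫
          ((E ⊗ E) ⊗ E) ◁ ((λ_ _).inv ≫ ε F ▷ F.obj (𝟙_ A))) ≫
          ten ((α_ E E _).hom ≫ E ◁ a (𝟙_ A) ≫ a (𝟙_ A)) (a (𝟙_ A)) ≫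
          η F ▷ F.obj (𝟙_ A) ≫ (λ_ _).hom := by
        simp only [Category.assoc]
    _ = (E ⊗ E) ◁ (ε F ≫ (λ_ _).inv ≫ ε F ▷ F.obj (𝟙_ A)) ≫ (α_ _ _ _).hom ≫
          (D.comul ▷ _ ≫ (E ⊗ E) ◁ rgt (a (𝟙_ A)) (F.obj (𝟙_ A))) ≫
          ten (a (𝟙_ A)) (a (𝟙_ A)) ≫ η F ▷ F.obj (𝟙_ A) ≫ (λ_ _).hom := by
        rw [← whisker_exchange, ← whisker_exchange_assoc, Category.assoc, Category.assoc,
          reassoc_of% (ten_cmp_left_braid (a (𝟙_ A)) (a (𝟙_ A)) (a (𝟙_ A)))]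
        monoidal
    _ = 𝟙 _ ⊗≫ E ◁ (E ◁ (ε F ≫ (λ_ _).inv ≫ ε F ▷ F.obj (𝟙_ A)) ≫
          rgt (a (𝟙_ A)) (F.obj (𝟙_ A))) ≫ E ◁ μ F (𝟙_ A) (𝟙_ A) ≫ a (𝟙_ A ⊗ 𝟙_ A) ≫
          δ F (𝟙_ A) (𝟙_ A) ≫ η F ▷ F.obj (𝟙_ A) ≫ (λ_ _).hom := by
        rw [← whisker_exchange, Category.assoc, reassoc_of% hD.comul]
        monoidal
    _ = 𝟙 _ ⊗≫ E ◁ (E ◁ ε F ≫ a (𝟙_ A)) ≫ (E ◁ F.map (ρ_ (𝟙_ A)).inv ≫ a (𝟙_ A ⊗ 𝟙_ A)) ≫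
          δ F (𝟙_ A) (𝟙_ A) ≫ η F ▷ F.obj (𝟙_ A) ≫ (λ_ _).hom := by
        rw [e₁, ← right_unitality_inv]
        monoidal
    _ = _ := by
        rw [h.naturality, Category.assoc, e₂]
        monoidal

lemma mul_mul_counit : D.mul ▷ E ≫ D.mul ≫ D.counit =
    (α_ E E E).hom ≫ E ◁ D.comul ▷ E ⊗≫
      ((D.mul ≫ D.counit) ⊗ₘ (D.mul ≫ D.counit)) ≫ (λ_ (𝟙_ B)).hom := by
  rw [reassoc_of% (hD.mul_associative h), ← hD.mul_mul_counit_aux (hD.comul_mul_counit_action h),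
    MonoidalCategory.tensorHom_def']
  monoidal

lemma mul_mul_counit' : D.mul ▷ E ≫ D.mul ≫ D.counit =
    (α_ E E E).hom ≫ E ◁ (D.comul ≫ (β_ E E).inv) ▷ E ⊗≫
      ((D.mul ≫ D.counit) ⊗ₘ (D.mul ≫ D.counit)) ≫ (λ_ (𝟙_ B)).hom := by
  rw [reassoc_of% (hD.mul_associative h), ← hD.mul_mul_counit_aux (hD.comul_mul_counit_action' h),
    ← counit_braiding_comul, MonoidalCategory.tensorHom_def']
  monoidal

end IsCanonicalData

end WeakUnitCounit

/-! ### Source and target maps, and the antipode axioms. -/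

section Antipode

variable {A : Type u₁} [Category.{v₁} A] [MonoidalCategory A]
  {B : Type u₂} [Category.{v₂} B] [MonoidalCategory B] [BraidedCategory B]
  {F : A ⥤ B} [F.LaxMonoidal] [F.OplaxMonoidal] {E : B}

open Functor.LaxMonoidal Functor.OplaxMonoidal

/-- The map `h ↦ 1₁ ε(h 1₂)` of raw data. -/
def HopfData.source (D : HopfData E) : E ⟶ E :=
  (ρ_ E).inv ≫ E ◁ (D.one ≫ D.comul) ⊗≫ (β_ E E).hom ▷ E ⊗≫
    E ◁ (D.mul ≫ D.counit) ≫ (ρ_ E).hom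

/-- The map `h ↦ ε(1₁ h) 1₂` of raw data. -/
def HopfData.target (D : HopfData E) : E ⟶ E :=
  (λ_ E).inv ≫ (D.one ≫ D.comul) ▷ E ⊗≫ E ◁ (β_ E E).hom ⊗≫
    (D.mul ≫ D.counit) ▷ E ≫ (λ_ E).hom

/-- The convolution product attached to raw data. -/
def HopfData.conv (D : HopfData E) (f g : E ⟶ E) : E ⟶ E :=
  D.comul ≫ (f ⊗ₘ g) ≫ D.mul

/-- Inserting a scalar to the left of a map with a parameter. -/
lemma comp_insert {X U V W W' : B} (f : X ⊗ U ⟶ V) (c : 𝟙_ B ⟶ W ⊗ W') :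
    f ≫ (λ_ V).inv ≫ c ▷ V ≫ (α_ W W' V).hom =
      X ◁ ((λ_ U).inv ≫ c ▷ U ≫ (α_ W W' U).hom) ≫ lft (lft f W') W := by
  have e := lft_naturality f c
  rw [lft_unit] at e
  rw [lft_lft]
  simp only [whiskerLeft_comp, Category.assoc]
  rw [← whiskerLeft_comp_assoc X (α_ W W' U).hom, Iso.hom_inv_id, whiskerLeft_id, Category.id_comp,
    reassoc_of% e]
  simp

section Frobenius

variable [IsSeparableFrobenius F]

/-- A Frobenius axiom makes the splitting of `F (x ⊗ y)` and the merging into `F (y ⊗ x)` internal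
to `F`, where the triangle identity applies. The final `η F` is left off because an element of `E`
still has to act on `F 𝟙`; in `map_coev_mapEv` the initial `ε F` is left off for the same reason. -/
lemma mapCoev_frobenius (x y : A) [ExactPairing x y] :
    ((λ_ (F.obj x)).inv ≫ mapCoev F x y ▷ F.obj x ≫ (α_ _ _ _).hom) ≫
      F.obj x ◁ (μ F y x ≫ F.map (ε_ x y)) = F.map (ρ_ x).inv ≫ δ F x (𝟙_ A) := by
  have e := IsSeparableFrobenius.frobenius_left (F := F) x y x
  simp only [mapCoev, comp_whiskerRight, whiskerLeft_comp, Category.assoc]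
  rw [reassoc_of% e, δ_natural_right, μ_natural_left_assoc, left_unitality_inv_assoc]
  simp only [← F.map_comp_assoc]
  rw [ExactPairing.evaluation_coevaluation]
  simp

lemma map_coev_mapEv (x y : A) [ExactPairing x y] :
    (F.map (η_ x y) ≫ δ F x y) ▷ F.obj x ≫ (α_ _ _ _).hom ≫ F.obj x ◁ mapEv F x y ≫
      (ρ_ (F.obj x)).hom = μ F (𝟙_ A) x ≫ F.map (λ_ x).hom := by
  have e := IsSeparableFrobenius.frobenius_left (F := F) x y x
  simp only [mapEv, comp_whiskerRight, whiskerLeft_comp, Category.assoc]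
  rw [reassoc_of% e, δ_natural_right_assoc, μ_natural_left_assoc]
  simp only [← F.map_comp_assoc]
  rw [ExactPairing.evaluation_coevaluation, F.map_comp, Category.assoc,
    counit_unit_right, Category.comp_id]

lemma δ_mapEv (x y : A) [ExactPairing x y] : δ F y x ≫ mapEv F x y = F.map (ε_ x y) ≫ η F := by
  rw [mapEv, ← Category.assoc, IsSeparableFrobenius.separable, Category.id_comp]

lemma mapCoev_μ (x y : A) [ExactPairing x y] :
    mapCoev F x y ≫ μ F x y = ε F ≫ F.map (η_ x y) := by
  rw [mapCoev, Category.assoc, Category.assoc, IsSeparableFrobenius.separable, Category.comp_id]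

end Frobenius

variable [RightRigidCategory A] {a : ∀ x, E ⊗ F.obj x ⟶ F.obj x} {D : HopfData E}

namespace IsCanonicalData

variable [RightRigidCategory B] [IsSeparableFrobenius F] (hD : IsCanonicalData a D)
  (h : IsUniversalAction F a)
include hD

/-- On `F x` and an inserted unit, `Δ(1)` acts by splitting off a copy of `F 𝟙` from `F x`; `h` acts
on that copy alone, which `η F` then removes. Dually, in `target_action` the element acts on a newly
created `F 𝟙`, which is then merged into `F x`. -/
lemma source_action (x : A) : D.source ▷ F.obj x ≫ a x =
    E ◁ (F.map (ρ_ x).inv ≫ δ F x (𝟙_ A)) ≫ lft (a (𝟙_ A)) (F.obj x) ≫ F.obj x ◁ η F ≫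
      (ρ_ (F.obj x)).hom := by
  have e : D.source = (ρ_ E).inv ≫ E ◁ (D.one ≫ D.comul) ≫
      ((α_ E E E).inv ≫ (β_ E E).hom ▷ E ≫ (α_ E E E).hom) ≫
        E ◁ (D.mul ≫ D.counit) ≫ (ρ_ E).hom := by
    rw [HopfData.source]; monoidal
  rw [e, comp_whiskerRight, comp_whiskerRight (E ◁ _), comp_whiskerRight (_ ≫ _ ≫ _),
    Category.assoc, Category.assoc, Category.assoc, whiskerLeft_scalar_param _ hD.mul_counit,
    ← whisker_exchange_assoc, reassoc_of% (ten_cmp_right (a x) (a (𝟙_ A)) (a (𝟙_ A))),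
    ← whisker_exchange_assoc, associator_naturality_middle_assoc, ← whiskerLeft_comp_assoc E
    ((D.one ≫ D.comul) ▷ _), hD.one_comul, ← right_unitality_inv]
  monoidal

lemma target_action (x : A) : D.target ▷ F.obj x ≫ a x =
    E ◁ ((λ_ (F.obj x)).inv ≫ ε F ▷ F.obj x) ≫ rgt (a (𝟙_ A)) (F.obj x) ≫ μ F (𝟙_ A) x ≫
      F.map (λ_ x).hom := by
  have e : D.target = (λ_ E).inv ≫ (D.one ≫ D.comul) ▷ E ≫
      ((α_ E E E).hom ≫ E ◁ (β_ E E).hom ≫ (α_ E E E).inv) ≫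
        (D.mul ≫ D.counit) ▷ E ≫ (λ_ E).hom := by
    rw [HopfData.target]; monoidal
  have e' : δ F (𝟙_ A) x ≫ η F ▷ F.obj x ≫ (λ_ (F.obj x)).hom = F.map (λ_ x).hom := by
    rw [← cancel_epi (F.map (λ_ x).inv), counit_unit_left, ← F.map_comp]
    simp
  rw [e, comp_whiskerRight, comp_whiskerRight (_ ▷ E), comp_whiskerRight (_ ≫ _ ≫ _),
    Category.assoc, Category.assoc, Category.assoc, whiskerRight_scalar_param _ hD.mul_counit,
    ← whisker_exchange_assoc, reassoc_of% (ten_cmp_left_braid (a (𝟙_ A)) (a (𝟙_ A)) (a x)),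
    ← whisker_exchange_assoc, associator_naturality_left_assoc, ← whisker_exchange_assoc,
    ← whisker_exchange_assoc, reassoc_of% hD.one_comul, ← e']
  monoidal

lemma conv_action (f g : E ⟶ E) (x : A) : D.conv f g ▷ F.obj x ≫ a x =
    D.comul ▷ F.obj x ≫ (α_ _ _ _).hom ≫ E ◁ (g ▷ F.obj x ≫ a x) ≫ f ▷ F.obj x ≫ a x := by
  simp only [HopfData.conv, comp_whiskerRight, Category.assoc, hD.mul]
  rw [MonoidalCategory.tensorHom_def', comp_whiskerRight, Category.assoc,
    associator_naturality_left_assoc, ← whisker_exchange_assoc]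
  monoidal

/-- Acting by `b` after the antipode. -/
lemma comul_antipode_action (x : A) (b : E ⊗ F.obj x ⟶ F.obj x) :
    D.comul ▷ F.obj x ≫ (α_ _ _ _).hom ≫ E ◁ (D.antipode ▷ F.obj x ≫ a x) ≫ b =
      E ◁ ((λ_ _).inv ≫ mapCoev F x (xᘁ) ▷ F.obj x) ≫
        rgt (D.comul ▷ _ ≫ ten b (a (xᘁ))) (F.obj x) ≫ (α_ _ _ _).hom ≫
          F.obj x ◁ mapEv F x (xᘁ) ≫ (ρ_ (F.obj x)).hom := by
  have e : E ◁ (F.obj x ◁ mapEv F x (xᘁ) ≫ (ρ_ (F.obj x)).hom) ≫ b =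
      rgt b _ ≫ F.obj x ◁ mapEv F x (xᘁ) ≫ (ρ_ (F.obj x)).hom := by
    rw [← reassoc_of% @rgt_naturality, rgt_unit]
    simp only [whiskerLeft_comp, Category.assoc, Iso.inv_hom_id, Category.comp_id]
  have e' := ten_rgt b (a (xᘁ)) (F.obj x)
  rw [ten_eq] at e'
  rw [hD.antipode, antipodeAction, ← param_rgt]
  calc _ = D.comul ▷ F.obj x ≫ (α_ _ _ _).hom ≫ E ◁ E ◁ ((λ_ (F.obj x)).inv ≫
        mapCoev F x (xᘁ) ▷ F.obj x ≫ (α_ _ _ _).hom) ≫ E ◁ lft (rgt (a (xᘁ)) (F.obj x)) (F.obj x) ≫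
        E ◁ (F.obj x ◁ mapEv F x (xᘁ) ≫ (ρ_ (F.obj x)).hom) ≫ b := by
        monoidal
    _ = (D.comul ▷ F.obj x ≫ (E ⊗ E) ◁ ((λ_ (F.obj x)).inv ≫
        mapCoev F x (xᘁ) ▷ F.obj x ≫ (α_ _ _ _).hom)) ≫ ((α_ _ _ _).hom ≫
        E ◁ lft (rgt (a (xᘁ)) (F.obj x)) (F.obj x) ≫ rgt b _) ≫
        F.obj x ◁ mapEv F x (xᘁ) ≫ (ρ_ (F.obj x)).hom := by
        rw [e]; monoidal
    _ = E ◁ ((λ_ (F.obj x)).inv ≫ mapCoev F x (xᘁ) ▷ F.obj x) ≫ (E ◁ (α_ _ _ _).hom ≫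
        D.comul ▷ _ ≫ (E ⊗ E) ◁ (α_ _ _ _).inv) ≫ rgt (ten b (a (xᘁ))) (F.obj x) ≫
        (α_ _ _ _).hom ≫ F.obj x ◁ mapEv F x (xᘁ) ≫ (ρ_ (F.obj x)).hom := by
        rw [← whisker_exchange, e']; monoidal
    _ = _ := by
        rw [← whisker_exchange]; monoidal

include h

/-- Once the coevaluation is moved before the action of `h₂`, the elements `h₁` and `h₂` act on `F
xᘁ ⊗ F x`, that is, `h` acts on `F (xᘁ ⊗ x)`. Separability absorbs the `δ` into the evaluation and
naturality carries the action to `F 𝟙`. -/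
lemma antipode_conv_id : D.conv D.antipode (𝟙 E) = D.source :=
  h.jointlyFaithful.hom_ext fun x => by
    rw [hD.conv_action, hD.source_action, id_whiskerRight, Category.id_comp, hD.antipode,
      antipodeAction, ← mapCoev_frobenius x (xᘁ)]
    have e := lft_cmp (lft (a x) (F.obj (xᘁ))) (rgt (a (xᘁ)) (F.obj x)) (F.obj x)
    rw [← ten_eq] at e
    calc _ = D.comul ▷ F.obj x ≫ (α_ _ _ _).hom ≫ E ◁ (a x ≫ (λ_ (F.obj x)).inv ≫
          mapCoev F x (xᘁ) ▷ F.obj x ≫ (α_ _ _ _).hom) ≫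
          lft (rgt (a (xᘁ)) (F.obj x)) (F.obj x) ≫
          F.obj x ◁ mapEv F x (xᘁ) ≫ (ρ_ (F.obj x)).hom := by monoidal
      _ = (D.comul ▷ F.obj x ≫ (E ⊗ E) ◁ ((λ_ (F.obj x)).inv ≫
          mapCoev F x (xᘁ) ▷ F.obj x ≫ (α_ _ _ _).hom)) ≫
          lft (ten (a (xᘁ)) (a x)) (F.obj x) ≫
          F.obj x ◁ mapEv F x (xᘁ) ≫ (ρ_ (F.obj x)).hom := by
          rw [comp_insert, e]; monoidal
      _ = _ := by
          rw [← whisker_exchange, Category.assoc, reassoc_of% @param_lft, hD.comul, ← reassoc_of% @lft_comp,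
            Category.assoc, Category.assoc, δ_mapEv, ← reassoc_of% h.naturality,
            ← whiskerLeft_comp_assoc, lft_precomp, lft_comp]
          simp only [whiskerLeft_comp, Category.assoc]

/-- Now `h` acts on `F (x ⊗ xᘁ)`, and by separability and naturality its action moves back along the
coevaluation to the unit. -/
lemma id_conv_antipode : D.conv (𝟙 E) D.antipode = D.target :=
  h.jointlyFaithful.hom_ext fun x => by
    have e : E ◁ (((λ_ _).inv ≫ mapCoev F x (xᘁ) ▷ F.obj x) ≫ μ F x (xᘁ) ▷ F.obj x) ≫
        rgt (a (x ⊗ xᘁ) ≫ δ F x (xᘁ)) (F.obj x) = E ◁ ((λ_ _).inv ≫ ε F ▷ F.obj x) ≫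
          rgt (a (𝟙_ A) ≫ F.map (η_ x (xᘁ)) ≫ δ F x (xᘁ)) (F.obj x) := by
      rw [Category.assoc, ← comp_whiskerRight, mapCoev_μ, comp_whiskerRight, ← Category.assoc,
        whiskerLeft_comp, Category.assoc, ← rgt_precomp, reassoc_of% h.naturality]
    rw [hD.conv_action, hD.target_action, id_whiskerRight, Category.id_comp,
      hD.comul_antipode_action, hD.comul, reassoc_of% @rgt_precomp, ← whiskerLeft_comp_assoc,
      Category.assoc (λ_ _).inv, reassoc_of% e, rgt_comp, Category.assoc, map_coev_mapEv]

/-- By the Frobenius axiom the copy of `F 𝟙` split off from `F x` is merged with `F y`, so `h₁` and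
`h₂` together become the action of `h` on `F (𝟙 ⊗ y)`. -/
lemma source_tensor_action (x y : A) :
    D.comul ▷ (F.obj x ⊗ F.obj y) ≫ ten (D.source ▷ F.obj x ≫ a x) (a y) =
      E ◁ (μ F x y ≫ δ F x y) ≫ lft (a y) (F.obj x) := by
  have e₁ : (F.map (ρ_ x).inv ≫ δ F x (𝟙_ A)) ▷ F.obj y ≫ (α_ _ _ _).hom ≫
      F.obj x ◁ μ F (𝟙_ A) y = μ F x y ≫ δ F x y ≫ F.obj x ◁ F.map (λ_ y).inv := by
    rw [comp_whiskerRight, Category.assoc, IsSeparableFrobenius.frobenius_left,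
      μ_natural_left_assoc, δ_natural_right, ← F.map_comp_assoc]
    simp
  have e₂ : δ F (𝟙_ A) y ≫ η F ▷ F.obj y ≫ (λ_ (F.obj y)).hom = F.map (λ_ y).hom := by
    rw [← cancel_epi (F.map (λ_ y).inv), counit_unit_left, ← F.map_comp]
    simp
  rw [hD.source_action, ten_precomp_left, ten_comp_left, ten_lft_left]
  calc _ = (D.comul ▷ _ ≫ (E ⊗ E) ◁ ((F.map (ρ_ x).inv ≫ δ F x (𝟙_ A)) ▷ F.obj y ≫
        (α_ _ _ _).hom)) ≫ lft (ten (a (𝟙_ A)) (a y)) (F.obj x) ≫ F.obj x ◁ (η F ▷ F.obj y ≫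
          (λ_ (F.obj y)).hom) := by
        monoidal
    _ = E ◁ ((F.map (ρ_ x).inv ≫ δ F x (𝟙_ A)) ▷ F.obj y ≫ (α_ _ _ _).hom ≫
        F.obj x ◁ μ F (𝟙_ A) y) ≫ lft (a (𝟙_ A ⊗ y) ≫ δ F (𝟙_ A) y ≫ η F ▷ F.obj y ≫
          (λ_ (F.obj y)).hom) (F.obj x) := by
        rw [← whisker_exchange, Category.assoc, reassoc_of% @param_lft, hD.comul, reassoc_of% @lft_precomp,
          ← lft_comp]
        simp only [whiskerLeft_comp, Category.assoc]
    _ = _ := by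
        rw [e₁, e₂, ← h.naturality, ← Category.assoc (μ F x y), whiskerLeft_comp, Category.assoc,
          ← lft_precomp, ← whiskerLeft_comp_assoc, ← F.map_comp]
        simp

lemma antipode_conv_id_conv_antipode :
    D.conv (D.conv D.antipode (𝟙 E)) D.antipode = D.antipode :=
  h.jointlyFaithful.hom_ext fun x => by
    -- After `S ⋆ id` is replaced by the source map, the two sides differ only by the idempotent `μ
    -- ≫ δ`, which `c_x` absorbs.
    have e : mapCoev F x (xᘁ) ≫ μ F x (xᘁ) ≫ δ F x (xᘁ) = mapCoev F x (xᘁ) := by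
      rw [← Category.assoc, mapCoev_μ, mapCoev, Category.assoc]
    rw [hD.antipode_conv_id h, hD.conv_action, hD.comul_antipode_action,
      hD.source_tensor_action h, reassoc_of% @rgt_precomp, ← whiskerLeft_comp_assoc, Category.assoc,
      ← comp_whiskerRight, e, hD.antipode, antipodeAction, lft_rgt]
    monoidal

end IsCanonicalData

end Antipode

/-! ### Assembly of the weak Hopf algebra. -/

section Main

variable {A : Type u₁} [Category.{v₁} A] [MonoidalCategory A]
  {B : Type u₂} [Category.{v₂} B] [MonoidalCategory B] [BraidedCategory B]
  {F : A ⥤ B} [F.LaxMonoidal] [F.OplaxMonoidal] [IsSeparableFrobenius F] {E : B}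
  [RightRigidCategory A] [RightRigidCategory B]
  {a : ∀ x, E ⊗ F.obj x ⟶ F.obj x} {D : HopfData E}

/-- The canonical structure on a universal object acting on `F` is a weak Hopf algebra. -/
@[reducible]
def IsCanonicalData.weakHopfObj (hD : IsCanonicalData a D) (h : IsUniversalAction F a) :
    WeakHopfObj E where
  one := D.one
  mul := D.mul
  counit := D.counit
  comul := D.comul
  antipode := D.antipode
  one_mul := hD.one_mul h
  mul_one := hD.mul_one h
  mul_assoc := hD.mul_associative h
  counit_comul := hD.counit_comul h
  comul_counit := hD.comul_counit h
  comul_assoc := hD.coassoc h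
  mul_comul := hD.mul_comul h
  one_comul_comul := hD.one_comul_comul h
  one_comul_comul' := hD.one_comul_comul' h
  mul_mul_counit := hD.mul_mul_counit h
  mul_mul_counit' := hD.mul_mul_counit' h
  antipode_convolution_id := hD.antipode_conv_id h
  id_convolution_antipode := hD.id_conv_antipode h
  antipode_convolution_id_convolution_antipode := hD.antipode_conv_id_conv_antipode h

theorem IsCanonicalData.exists_weakHopfObj (hD : IsCanonicalData a D)
    (h : IsUniversalAction F a) : ∃ W : WeakHopfObj E, W.data = D :=
  ⟨hD.weakHopfObj h, rfl⟩

end Main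

/-! ### Transposition along duals and mates of morphisms. -/

section Mates

variable {C : Type u₂} [Category.{v₂} C] [MonoidalCategory C]

/-- This turns the wedge condition on projections into naturality of the transposed actions;
`tensorRightHomEquiv_leftAdjointMate` does so for cowedges and coactions. -/
lemma tensorRightHomEquiv_rightAdjointMate [RightRigidCategory C] {X Y V Z : C} (f : X ⟶ Y)
    (q : V ⊗ Y ⟶ Z) : tensorRightHomEquiv V X (Xᘁ) Z (V ◁ f ≫ q) =
      tensorRightHomEquiv V Y (Yᘁ) Z q ≫ Z ◁ (fᘁ) := by
  simp only [tensorRightHomEquiv, Equiv.coe_fn_mk, Category.assoc]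
  rw [← whisker_exchange, comp_whiskerRight]
  calc _ = 𝟙 _ ⊗≫ V ◁ (η_ X (Xᘁ) ≫ f ▷ (Xᘁ)) ⊗≫ q ▷ (Xᘁ) := by monoidal
    _ = _ := by rw [← coevaluation_comp_rightAdjointMate]; monoidal

lemma tensorRightHomEquiv_leftAdjointMate [LeftRigidCategory C] {X Y V Z : C} (f : X ⟶ Y)
    (p : V ⊗ (ᘁX) ⟶ Z) : tensorRightHomEquiv V (ᘁY) Y Z (V ◁ (ᘁf) ≫ p) =
      tensorRightHomEquiv V (ᘁX) X Z p ≫ Z ◁ f := by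
  simp only [tensorRightHomEquiv, Equiv.coe_fn_mk, Category.assoc]
  rw [← whisker_exchange, comp_whiskerRight]
  calc _ = 𝟙 _ ⊗≫ V ◁ (η_ (ᘁY) Y ≫ (ᘁf) ▷ Y) ⊗≫ p ▷ Y := by monoidal
    _ = _ := by rw [coevaluation_comp_leftAdjointMate]; monoidal

lemma tensorRightHomEquiv_comp {V Y Y' Z Z' : C} [ExactPairing Y Y'] (q : V ⊗ Y ⟶ Z)
    (g : Z ⟶ Z') : tensorRightHomEquiv V Y Y' Z' (q ≫ g) =
      tensorRightHomEquiv V Y Y' Z q ≫ g ▷ Y' := by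
  simp [tensorRightHomEquiv]

lemma tensorRightHomEquiv_precomp {V V' Y Y' Z : C} [ExactPairing Y Y'] (q : V ⊗ Y ⟶ Z)
    (g : V' ⟶ V) : tensorRightHomEquiv V' Y Y' Z (g ▷ Y ≫ q) =
      g ≫ tensorRightHomEquiv V Y Y' Z q := by
  simp only [tensorRightHomEquiv, Equiv.coe_fn_mk, comp_whiskerRight]
  rw [rightUnitor_inv_naturality_assoc, ← whisker_exchange_assoc]
  monoidal

end Mates

/-! ### Ends and coends as universal actions and coactions. -/

section Ends

variable {A : Type u₁} [Category.{v₁} A] {B : Type u₂} [Category.{v₂} B] [MonoidalCategory B]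
  {F : A ⥤ B}

lemma tensorRightHomEquiv_action [RightRigidCategory B] (c : Wedge (homFunctor F)) (x : A) :
    tensorRightHomEquiv c.pt (F.obj x) ((F.obj x)ᘁ) (F.obj x) (action c x) = proj c x :=
  -- By its definition `action c x` unfolds to the inverse transpose of `proj c x`.
  Equiv.apply_symm_apply (tensorRightHomEquiv c.pt (F.obj x) ((F.obj x)ᘁ) (F.obj x)) (proj c x)

lemma existsUnique_proj [RightRigidCategory B] {c : Wedge (homFunctor F)} (hc : IsLimit c)
    {X : B} (f : ∀ x, X ⟶ F.obj x ⊗ (F.obj x)ᘁ)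
    (hf : ∀ ⦃x y : A⦄ (g : x ⟶ y), f x ≫ F.map g ▷ (F.obj x)ᘁ = f y ≫ F.obj y ◁ (F.map g)ᘁ) :
    ∃! p : X ⟶ c.pt, ∀ x, p ≫ proj c x = f x :=
  ⟨Wedge.IsLimit.lift hc f hf, Wedge.IsLimit.lift_ι hc f hf, fun _ hp =>
    Wedge.IsLimit.hom_ext hc fun x => (hp x).trans (Wedge.IsLimit.lift_ι hc f hf x).symm⟩

lemma existsUnique_incl [LeftRigidCategory B] {c : Cowedge (cohomFunctor F)} (hc : IsColimit c)
    {X : B} (f : ∀ x, F.obj x ⊗ (ᘁ(F.obj x)) ⟶ X)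
    (hf : ∀ ⦃x y : A⦄ (g : x ⟶ y), F.obj x ◁ (ᘁ(F.map g)) ≫ f x = F.map g ▷ (ᘁ(F.obj y)) ≫ f y) :
    ∃! p : c.pt ⟶ X, ∀ x, incl c x ≫ p = f x :=
  ⟨Cowedge.IsColimit.desc hc f hf, Cowedge.IsColimit.π_desc hc f hf, fun _ hp =>
    Cowedge.IsColimit.hom_ext hc fun x => (hp x).trans (Cowedge.IsColimit.π_desc hc f hf x).symm⟩

/-- The end of `[F a, F a]` acts universally on `F`. -/
theorem isUniversalAction_action [RightRigidCategory B] {c : Wedge (homFunctor F)}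
    (hc : IsLimit c) : IsUniversalAction F (action c) where
  naturality x y f := by
    rw [← (tensorRightHomEquiv c.pt (F.obj x) ((F.obj x)ᘁ) (F.obj y)).apply_eq_iff_eq,
      tensorRightHomEquiv_rightAdjointMate, tensorRightHomEquiv_comp, tensorRightHomEquiv_action,
      tensorRightHomEquiv_action]
    exact (Wedge.condition c f).symm
  existsUnique X φ hφ := by
    obtain ⟨p, hp, hu⟩ := existsUnique_proj hc
      (fun x => tensorRightHomEquiv X (F.obj x) ((F.obj x)ᘁ) (F.obj x) (φ x)) fun x y f => by
        rw [← tensorRightHomEquiv_comp, ← hφ, tensorRightHomEquiv_rightAdjointMate]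
    have key (p : X ⟶ c.pt) (x : A) : p ▷ F.obj x ≫ action c x = φ x ↔ p ≫ proj c x =
        tensorRightHomEquiv X (F.obj x) ((F.obj x)ᘁ) (F.obj x) (φ x) := by
      rw [← (tensorRightHomEquiv X (F.obj x) ((F.obj x)ᘁ) (F.obj x)).apply_eq_iff_eq,
        tensorRightHomEquiv_precomp, tensorRightHomEquiv_action]
    exact ⟨p, fun x => (key p x).2 (hp x), fun q hq => hu q fun x => (key q x).1 (hq x)⟩

lemma coaction_eq [LeftRigidCategory B] (c : Cowedge (cohomFunctor F)) (x : A) :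
    coaction c x = tensorRightHomEquiv (F.obj x) (ᘁ(F.obj x)) (F.obj x) c.pt (incl c x) := rfl

lemma coaction_naturality [LeftRigidCategory B] (c : Cowedge (cohomFunctor F)) {x y : A}
    (f : x ⟶ y) : coaction c x ≫ c.pt ◁ F.map f = F.map f ≫ coaction c y := by
  rw [coaction_eq, coaction_eq, ← tensorRightHomEquiv_leftAdjointMate,
    ← tensorRightHomEquiv_precomp]
  exact congrArg _ (Cowedge.condition c f)

lemma existsUnique_of_isColimit [LeftRigidCategory B] {c : Cowedge (cohomFunctor F)}
    (hc : IsColimit c) {X : B} (φ : ∀ x, F.obj x ⟶ X ⊗ F.obj x)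
    (hφ : ∀ ⦃x y : A⦄ (f : x ⟶ y), φ x ≫ X ◁ F.map f = F.map f ≫ φ y) :
    ∃! p : c.pt ⟶ X, ∀ x, coaction c x ≫ p ▷ F.obj x = φ x := by
  obtain ⟨p, hp, hu⟩ := existsUnique_incl hc
    (fun x => (tensorRightHomEquiv (F.obj x) (ᘁ(F.obj x)) (F.obj x) X).symm (φ x)) fun x y f => by
      apply (tensorRightHomEquiv (F.obj x) (ᘁ(F.obj y)) (F.obj y) X).injective
      rw [tensorRightHomEquiv_leftAdjointMate, tensorRightHomEquiv_precomp,
        Equiv.apply_symm_apply, Equiv.apply_symm_apply, hφ]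
  have key (p : c.pt ⟶ X) (x : A) : coaction c x ≫ p ▷ F.obj x = φ x ↔ incl c x ≫ p =
      (tensorRightHomEquiv (F.obj x) (ᘁ(F.obj x)) (F.obj x) X).symm (φ x) := by
    rw [Equiv.eq_symm_apply, tensorRightHomEquiv_comp, coaction_eq]
  exact ⟨p, fun x => (key p x).2 (hp x), fun q hq => hu q fun x => (key q x).1 (hq x)⟩

end Ends

/-! ### Duality between the end form and the coend form. -/

section Opposite

variable {A : Type u₁} [Category.{v₁} A] [MonoidalCategory A]
  {B : Type u₂} [Category.{v₂} B] [MonoidalCategory B]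

open Functor.LaxMonoidal Functor.OplaxMonoidal

instance opLaxMonoidal (F : A ⥤ B) [F.OplaxMonoidal] : F.op.LaxMonoidal where
  ε := (η F).op
  μ X Y := (δ F X.unop Y.unop).op
  μ_natural_left f X := Quiver.Hom.unop_inj (δ_natural_left F f.unop X.unop)
  μ_natural_right X f := Quiver.Hom.unop_inj (δ_natural_right F X.unop f.unop)
  associativity X Y Z := Quiver.Hom.unop_inj <| by
    have := Functor.OplaxMonoidal.associativity_inv F X.unop Y.unop Z.unop
    -- Reversing arrows also reverses the bracketing of composites, so they are bracketed to the
    -- left before being matched definitionally.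
    simp only [← Category.assoc] at this
    exact this.symm
  left_unitality X := Quiver.Hom.unop_inj (by simp)
  right_unitality X := Quiver.Hom.unop_inj (by simp)

instance opOplaxMonoidal (F : A ⥤ B) [F.LaxMonoidal] : F.op.OplaxMonoidal where
  η := (ε F).op
  δ X Y := (μ F X.unop Y.unop).op
  δ_natural_left f X := Quiver.Hom.unop_inj (μ_natural_left F f.unop X.unop)
  δ_natural_right X f := Quiver.Hom.unop_inj (μ_natural_right F X.unop f.unop)
  oplax_associativity X Y Z := Quiver.Hom.unop_inj <| by
    have := Functor.LaxMonoidal.associativity_inv F X.unop Y.unop Z.unop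
    simp only [← Category.assoc] at this
    exact this.symm
  oplax_left_unitality X := Quiver.Hom.unop_inj (by simp)
  oplax_right_unitality X := Quiver.Hom.unop_inj (by simp)

instance op_isSeparableFrobenius (F : A ⥤ B) [F.LaxMonoidal] [F.OplaxMonoidal]
    [IsSeparableFrobenius F] : IsSeparableFrobenius F.op where
  frobenius_left x y z := Quiver.Hom.unop_inj <| by
    have := IsSeparableFrobenius.frobenius_right (F := F) x.unop y.unop z.unop
    simp only [← Category.assoc] at this
    exact this
  frobenius_right x y z := Quiver.Hom.unop_inj <| by
    have := IsSeparableFrobenius.frobenius_left (F := F) x.unop y.unop z.unop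
    simp only [← Category.assoc] at this
    exact this
  separable x y := Quiver.Hom.unop_inj (IsSeparableFrobenius.separable (F := F) x.unop y.unop)

/-- Passing to `Bᵒᵖ` keeps the order of tensor factors and exchanges evaluation with coevaluation,
so dual pairs change handedness. -/
instance opRightRigidCategory [LeftRigidCategory B] : RightRigidCategory Bᵒᵖ where
  rightDual X :=
    { rightDual := op (ᘁX.unop)
      exact :=
        { coevaluation' := (ε_ (ᘁX.unop) X.unop).op
          evaluation' := (η_ (ᘁX.unop) X.unop).op
          coevaluation_evaluation' := Quiver.Hom.unop_inj <| by
            have := ExactPairing.evaluation_coevaluation (ᘁX.unop) X.unop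
            rw [← Category.assoc] at this
            exact this
          evaluation_coevaluation' := Quiver.Hom.unop_inj <| by
            have := ExactPairing.coevaluation_evaluation (ᘁX.unop) X.unop
            rw [← Category.assoc] at this
            exact this } }

variable [BraidedCategory B] {F : A ⥤ B}

/-- The data on `op E` obtained by reversing all the structure maps. -/
def HopfData.op {E : B} (D : HopfData E) : HopfData (op E) where
  one := D.counit.op
  mul := D.comul.op
  counit := D.one.op
  comul := D.mul.op
  antipode := D.antipode.op

/-- The data on `E` obtained from data on `op E` by reversing all the structure maps. -/
def HopfData.unop {E : B} (D : HopfData (Opposite.op E)) : HopfData E where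
  one := D.counit.unop
  mul := D.comul.unop
  counit := D.one.unop
  comul := D.mul.unop
  antipode := D.antipode.unop

/-- The axioms of a weak Hopf algebra are self-dual. -/
@[reducible]
def WeakHopfObj.unop {E : B} (W : WeakHopfObj (Opposite.op E)) : WeakHopfObj E where
  one := W.counit.unop
  mul := W.comul.unop
  counit := W.one.unop
  comul := W.mul.unop
  antipode := W.antipode.unop
  one_mul := congrArg Quiver.Hom.unop W.counit_comul
  mul_one := congrArg Quiver.Hom.unop W.comul_counit
  mul_assoc := by
    have e : (W.comul ≫ W.comul ▷ _) = (W.comul ≫ _ ◁ W.comul) ≫ (α_ _ _ _).inv := by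
      rw [W.comul_assoc]; simp
    exact congrArg Quiver.Hom.unop e
  counit_comul := congrArg Quiver.Hom.unop W.one_mul
  comul_counit := congrArg Quiver.Hom.unop W.mul_one
  comul_assoc := by
    have e : _ ◁ W.mul ≫ W.mul = ((α_ _ _ _).inv ≫ W.mul ▷ _) ≫ W.mul := by
      rw [Category.assoc, W.mul_assoc]; simp
    exact congrArg Quiver.Hom.unop e
  mul_comul := by
    have e := congrArg Quiver.Hom.unop W.mul_comul
    rw [← Category.assoc, unop_comp, unop_comp, unop_comp, BraidedCategory.unop_tensorμ] at e
    exact e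
  one_comul_comul := by
    -- The weak counit axiom of `W` gives the weak unit axiom. The coherence composition `⊗≫` is
    -- first expanded into explicit associators, whose opposites are known definitionally.
    have e : (W.mul ▷ Opposite.op E ≫ W.mul) ≫ W.counit =
        (((((α_ _ _ _).hom ≫ _ ◁ W.comul ▷ _) ≫ _ ◁ (α_ _ _ _).hom) ≫ (α_ _ _ _).inv) ≫
          ((W.mul ≫ W.counit) ⊗ₘ (W.mul ≫ W.counit))) ≫ (λ_ (𝟙_ _)).hom := by
      rw [Category.assoc, W.mul_mul_counit]
      monoidal
    refine (congrArg Quiver.Hom.unop e).trans (show (λ_ (𝟙_ B)).inv ≫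
      ((W.counit.unop ≫ W.mul.unop) ⊗ₘ (W.counit.unop ≫ W.mul.unop)) ≫ (α_ _ _ _).hom ≫
        E ◁ (α_ _ _ _).inv ≫ E ◁ W.comul.unop ▷ E ≫ (α_ E E E).inv = _ from ?_)
    monoidal
  one_comul_comul' := by
    have e : (W.mul ▷ Opposite.op E ≫ W.mul) ≫ W.counit =
        (((((α_ _ _ _).hom ≫ _ ◁ (W.comul ≫ (β_ _ _).inv) ▷ _) ≫ _ ◁ (α_ _ _ _).hom) ≫ (α_ _ _ _).inv) ≫
          ((W.mul ≫ W.counit) ⊗ₘ (W.mul ≫ W.counit))) ≫ (λ_ (𝟙_ _)).hom := by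
      rw [Category.assoc, W.mul_mul_counit']
      monoidal
    refine (congrArg Quiver.Hom.unop e).trans (show (λ_ (𝟙_ B)).inv ≫
      ((W.counit.unop ≫ W.mul.unop) ⊗ₘ (W.counit.unop ≫ W.mul.unop)) ≫ (α_ _ _ _).hom ≫
        E ◁ (α_ _ _ _).inv ≫ E ◁ ((β_ E E).inv ≫ W.comul.unop) ▷ E ≫ (α_ E E E).inv = _ from ?_)
    monoidal
  mul_mul_counit := by
    have e : (W.one ≫ W.comul) ≫ W.comul ▷ Opposite.op E =
        (((((λ_ (𝟙_ _)).inv ≫ ((W.one ≫ W.comul) ⊗ₘ (W.one ≫ W.comul))) ≫ (α_ _ _ _).hom) ≫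
          _ ◁ (α_ _ _ _).inv) ≫ _ ◁ W.mul ▷ _) ≫ (α_ _ _ _).inv := by
      rw [Category.assoc, W.one_comul_comul]
      monoidal
    refine (congrArg Quiver.Hom.unop e).trans (show (α_ E E E).hom ≫ E ◁ W.mul.unop ▷ E ≫
      E ◁ (α_ _ _ _).hom ≫ (α_ _ _ _).inv ≫
        ((W.comul.unop ≫ W.one.unop) ⊗ₘ (W.comul.unop ≫ W.one.unop)) ≫ (λ_ (𝟙_ B)).hom = _ from ?_)
    monoidal
  mul_mul_counit' := by
    have e : (W.one ≫ W.comul) ≫ W.comul ▷ Opposite.op E =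
        (((((λ_ (𝟙_ _)).inv ≫ ((W.one ≫ W.comul) ⊗ₘ (W.one ≫ W.comul))) ≫ (α_ _ _ _).hom) ≫
          _ ◁ (α_ _ _ _).inv) ≫ _ ◁ ((β_ _ _).inv ≫ W.mul) ▷ _) ≫ (α_ _ _ _).inv := by
      rw [Category.assoc, W.one_comul_comul']
      monoidal
    refine (congrArg Quiver.Hom.unop e).trans (show (α_ E E E).hom ≫ E ◁ (W.mul.unop ≫ (β_ E E).inv) ▷ E ≫
      E ◁ (α_ _ _ _).hom ≫ (α_ _ _ _).inv ≫
        ((W.comul.unop ≫ W.one.unop) ⊗ₘ (W.comul.unop ≫ W.one.unop)) ≫ (λ_ (𝟙_ B)).hom = _ from ?_)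
    monoidal
  antipode_convolution_id := by
    -- Source maps go to source maps: the braiding of `Bᵒᵖ` on `E` is the opposite of `β` itself,
    -- not of its inverse, and the order of tensor factors is kept.
    have e : convolution W.antipode (𝟙 _) = ((((((ρ_ _).inv ≫ _ ◁ (W.one ≫ W.comul)) ≫
        (α_ _ _ _).inv) ≫ (β_ _ _).hom ▷ _) ≫ (α_ _ _ _).hom) ≫ _ ◁ (W.mul ≫ W.counit)) ≫
          (ρ_ _).hom := by
      rw [W.antipode_convolution_id, sourceMap]
      monoidal
    rw [convolution, ← Category.assoc] at e
    refine (congrArg Quiver.Hom.unop e).trans (show (ρ_ E).inv ≫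
      E ◁ (W.counit.unop ≫ W.mul.unop) ≫ (α_ _ _ _).inv ≫ (β_ E E).hom ▷ E ≫ (α_ _ _ _).hom ≫
        E ◁ (W.comul.unop ≫ W.one.unop) ≫ (ρ_ E).hom = _ from ?_)
    rw [sourceMap]
    monoidal
  id_convolution_antipode := by
    have e : convolution (𝟙 _) W.antipode = ((((((λ_ _).inv ≫ (W.one ≫ W.comul) ▷ _) ≫
        (α_ _ _ _).hom) ≫ _ ◁ (β_ _ _).hom) ≫ (α_ _ _ _).inv) ≫ (W.mul ≫ W.counit) ▷ _) ≫
          (λ_ _).hom := by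
      rw [W.id_convolution_antipode, targetMap]
      monoidal
    rw [convolution, ← Category.assoc] at e
    refine (congrArg Quiver.Hom.unop e).trans (show (λ_ E).inv ≫
      (W.counit.unop ≫ W.mul.unop) ▷ E ≫ (α_ _ _ _).hom ≫ E ◁ (β_ E E).hom ≫ (α_ _ _ _).inv ≫
        (W.comul.unop ≫ W.one.unop) ▷ E ≫ (λ_ E).hom = _ from ?_)
    rw [targetMap]
    monoidal
  antipode_convolution_id_convolution_antipode := by
    have e := W.antipode_convolution_id_convolution_antipode
    simp only [convolution, ← Category.assoc] at e
    exact congrArg Quiver.Hom.unop e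

variable [F.LaxMonoidal] [F.OplaxMonoidal]

lemma isCanonical_iff [RightRigidCategory A] [RightRigidCategory B]
    (c : Wedge (homFunctor F)) (D : HopfData c.pt) :
    IsCanonical c D ↔ IsCanonicalData (action c) D := by
  have e (x : A) : antipodeAction (action c) x (xᘁ) =
      c.pt ◁ (λ_ (F.obj x)).inv ≫ c.pt ◁ mapCoev F x (xᘁ) ▷ F.obj x ⊗≫
      (β_ c.pt (F.obj x)).hom ▷ (F.obj (xᘁ) ⊗ F.obj x) ⊗≫
        F.obj x ◁ action c (xᘁ) ▷ F.obj x ≫ F.obj x ◁ mapEv F x (xᘁ) ≫ (ρ_ (F.obj x)).hom := by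
    simp only [antipodeAction, lft, rgt]
    monoidal
  exact ⟨fun h => ⟨h.one, h.mul, h.counit, h.comul, fun x => (h.antipode x).trans (e x).symm⟩,
    fun h => ⟨h.one, h.mul, h.counit, h.comul, fun x => (h.antipode x).trans (e x)⟩⟩

lemma isUniversalAction_coaction [LeftRigidCategory B] {c : Cowedge (cohomFunctor F)}
    (hc : IsColimit c) :
    IsUniversalAction F.op (E := op c.pt) (fun x => (coaction c x.unop).op) where
  naturality x y f := Quiver.Hom.unop_inj (coaction_naturality c f.unop)
  existsUnique X φ hφ := by
    obtain ⟨p, hp, hu⟩ := existsUnique_of_isColimit hc (X := X.unop) (fun x => (φ (op x)).unop)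
      fun x y f => congrArg Quiver.Hom.unop (hφ f.op)
    exact ⟨p.op, fun x => congrArg Quiver.Hom.op (hp x.unop), fun q hq =>
      congrArg Quiver.Hom.op (hu q.unop fun x => congrArg Quiver.Hom.unop (hq (op x)))⟩

lemma unop_mapCoev_op [LeftRigidCategory A] (x : Aᵒᵖ) :
    (mapCoev F.op x (xᘁ)).unop = mapEv F (ᘁx.unop) x.unop :=
  Category.assoc (μ F x.unop (ᘁx.unop)) (F.map (ε_ (ᘁx.unop) x.unop)) (η F)

lemma unop_mapEv_op [LeftRigidCategory A] (x : Aᵒᵖ) :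
    (mapEv F.op x (xᘁ)).unop = mapCoev F (ᘁx.unop) x.unop :=
  Category.assoc (ε F) (F.map (η_ (ᘁx.unop) x.unop)) (δ F (ᘁx.unop) x.unop)

lemma unop_antipodeAction_op [LeftRigidCategory A] {E : B}
    (a : ∀ x, F.obj x ⟶ E ⊗ F.obj x) (x : Aᵒᵖ) :
    (antipodeAction (F := F.op) (E := op E) (fun x => (a x.unop).op) x (xᘁ)).unop =
      (ρ_ (F.obj x.unop)).inv ≫ F.obj x.unop ◁ mapCoev F (ᘁx.unop) x.unop ≫
        F.obj x.unop ◁ a (ᘁx.unop) ▷ F.obj x.unop ⊗≫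
        (β_ (F.obj x.unop) E).hom ▷ (F.obj (ᘁx.unop) ⊗ F.obj x.unop) ⊗≫
        E ◁ mapEv F (ᘁx.unop) x.unop ▷ F.obj x.unop ≫ E ◁ (λ_ (F.obj x.unop)).hom := by
  rw [← unop_mapCoev_op, ← unop_mapEv_op]
  refine Eq.trans (show _ = (((ρ_ (F.obj x.unop)).inv ≫
    F.obj x.unop ◁ (mapEv F.op x (xᘁ)).unop) ≫ (((F.obj x.unop ◁ (a (ᘁx.unop) ▷ F.obj x.unop ≫
      (α_ _ _ _).hom) ≫ (α_ _ _ _).inv) ≫ (β_ (F.obj x.unop) E).hom ▷ _) ≫ (α_ _ _ _).hom)) ≫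
        E ◁ (((α_ _ _ _).inv ≫ (mapCoev F.op x (xᘁ)).unop ▷ F.obj x.unop) ≫
          (λ_ (F.obj x.unop)).hom) from rfl) ?_
  monoidal

lemma op_coaction₂ [LeftRigidCategory B] (c : Cowedge (cohomFunctor F)) (x y : A) :
    (coaction₂ c x y).op = ten (X := op c.pt) (Y := op c.pt) (U := op (F.obj x))
      (U' := op (F.obj y)) (V := op (F.obj x)) (V' := op (F.obj y))
      (coaction c x).op (coaction c y).op := by
  rw [coaction₂, op_comp, BraidedCategory.op_tensorμ]
  rfl

/-- Reversing arrows exchanges unit with counit, multiplication with comultiplication, and `c'_x`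
with `d'_x`; apart from bracketing and `op_coaction₂`, the equations match definitionally. -/
lemma isCocanonical_iff [LeftRigidCategory A] [LeftRigidCategory B]
    (c : Cowedge (cohomFunctor F)) (D : HopfData c.pt) :
    IsCocanonical c D ↔ IsCanonicalData (F := F.op) (E := op c.pt)
      (fun x => (coaction c x.unop).op) D.op := by
  have e : ε F ≫ coaction c (𝟙_ A) ≫ c.pt ◁ η F ≫ (ρ_ c.pt).hom =
      ((ε F ≫ coaction c (𝟙_ A)) ≫ c.pt ◁ η F) ≫ (ρ_ c.pt).hom := by
    simp only [Category.assoc]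
  constructor
  · intro h
    refine ⟨fun x => congrArg Quiver.Hom.op (h.counit x.unop),
      fun x => congrArg Quiver.Hom.op ((h.comul x.unop).trans (Category.assoc _ _ _).symm),
      congrArg Quiver.Hom.op (h.one.trans e), fun x y => ?_, fun x => Quiver.Hom.unop_inj ?_⟩
    · have := congrArg Quiver.Hom.op (h.mul x.unop y.unop)
      rw [op_comp, op_coaction₂, ← Category.assoc] at this
      exact this
    · exact (h.antipode x.unop).trans (unop_antipodeAction_op _ x).symm
  · intro h
    refine ⟨fun x => congrArg Quiver.Hom.unop (h.one (op x)),
      fun x => (congrArg Quiver.Hom.unop (h.mul (op x))).trans (Category.assoc _ _ _),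
      (congrArg Quiver.Hom.unop h.counit).trans e.symm, fun x y => Quiver.Hom.op_inj ?_,
      fun x => (congrArg Quiver.Hom.unop (h.antipode (op x))).trans (unop_antipodeAction_op _ _)⟩
    · rw [op_comp, op_coaction₂, ← Category.assoc]
      exact h.comul (op x) (op y)

end Opposite

end WeakTannaka

open WeakTannaka in
theorem mainTheorem2 {A : Type u₁} [Category.{v₁} A] [MonoidalCategory A]
    {B : Type u₂} [Category.{v₂} B] [MonoidalCategory B] [BraidedCategory B]
    (F : A ⥤ B) [F.LaxMonoidal] [F.OplaxMonoidal] [WeakTannaka.IsSeparableFrobenius F] :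
    (∀ [RightRigidCategory A] [RightRigidCategory B]
      (c : Wedge (WeakTannaka.homFunctor F)) (_ : IsLimit c),
      (∃! D : WeakTannaka.HopfData c.pt, WeakTannaka.IsCanonical c D) ∧
      ∀ D : WeakTannaka.HopfData c.pt, WeakTannaka.IsCanonical c D →
        ∃ W : WeakTannaka.WeakHopfObj c.pt, W.data = D) ∧
    (∀ [LeftRigidCategory A] [LeftRigidCategory B]
      (c : Cowedge (WeakTannaka.cohomFunctor F)) (_ : IsColimit c),
      (∃! D : WeakTannaka.HopfData c.pt, WeakTannaka.IsCocanonical c D) ∧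
      ∀ D : WeakTannaka.HopfData c.pt, WeakTannaka.IsCocanonical c D →
        ∃ W : WeakTannaka.WeakHopfObj c.pt, W.data = D) := by
  constructor
  · intro _ _ c hc
    simp only [isCanonical_iff]
    have h := isUniversalAction_action hc
    exact ⟨existsUnique_isCanonicalData h, fun D hD => hD.exists_weakHopfObj h⟩
  · intro _ _ c hc
    simp only [isCocanonical_iff]
    have h := isUniversalAction_coaction hc
    obtain ⟨D, hD, hu⟩ := existsUnique_isCanonicalData h
    -- `D.unop.op` is `D` by definition, so `hD` serves as it stands.
    refine ⟨⟨D.unop, hD, fun D' hD' => congrArg HopfData.unop (hu D'.op hD')⟩, fun D hD => ?_⟩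
    obtain ⟨W, hW⟩ := hD.exists_weakHopfObj h
    exact ⟨W.unop, congrArg HopfData.unop hW⟩
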